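/- Let $(k,\sigma)$ be a difference field (a field with a ring endomorphism) and let $(\bar k,\bar\sigma)$ be a separable closure of it, i.e. $\bar k$ is a separable closure of the field $k$ and $\bar\sigma$ is a ring endomorphism of $\bar k$ extending $\sigma$. Let $G=\mathrm{Gal}(\bar k/k)$ with the Krull topology and with the continuous endomorphism $g\mapsto g^{\sigma}$ determined by $\bar\sigma\circ g^{\sigma}=g\circ\bar\sigma$. A *difference $k$-algebra* is a commutative $k$-algebra $A$ with a ring endomorphism $\sigma_A$ extending $\sigma$; morphisms are $k$-algebra homomorphisms commuting with the endomorphisms. $A$ is *difference locally étale* if $(\bar k\otimes_kA,\ \bar\sigma\otimes\sigma_A)$ is isomorphic, as a difference $\bar k$-algebra, to $(\mathrm{Cont}(X,\bar k),\ f\mapsto\bar\sigma\circ f\circ\sigma_X)$ for some profinite space $X$ with a continuous self-map $\sigma_X$, where $\bar k$ is discrete. For a $k$-algebra $A_0$, let $[A_0]_\sigma$ be the free difference $k$-algebra on $A_0$ (the left adjoint of the functor forgetting the endomorphism). For a cocorrespondence $A_0\xrightarrow{p}C_0\xleftarrow{s}A_0$, where $p$ is a $k$-algebra homomorphism and $s$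 is a ring homomorphism linear over $\sigma$, let $[A_0;C_0]_\sigma$ be its image under the left adjoint of the functor sending $A$ to $A\xrightarrow{\mathrm{id}}A\xleftarrow{\sigma_A}A$. A difference $k$-algebra $A$ is *finitely $\sigma$-generated étale* if it is difference locally étale and is a quotient of $[A_0]_\sigma$ for some finitely generated étale $k$-algebra $A_0$. It is *finitely $\sigma$-presented étale* if $A\simeq[A_0;C_0]_\sigma$ for some cocorrespondence with $A_0$ and $C_0$ finitely generated étale $k$-algebras. A *difference profinite $G$-set* is a profinite space $X$ with a continuous $G$-action and a continuous map $\sigma_X:X\to X$ such that $\sigma_X(gx)=g^{\sigma}\sigma_X(x)$; morphisms are continuous $G$-equivariant maps commuting with the self-maps. It is *finitely freely $\sigma$-generated* if it is isomorphic to $\prod_{i\in\mathbb N}X_0$ for a finite discrete set $X_0$ with a continuous $G$-action, where $G$ acts on the $i$-th factor through the $i$-th iterate of $g\mapsto g^{\sigma}$ and the self-map is the left shift. It is *finitely $\sigma$-generated* if it is a subobject of a finitely freely $\sigma$-generated one, and *finitely $\sigma$-presented* if it is an equaliser of a pair of morphisms between two finitely freely $\sigma$-generated ones. **Corollary.** The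 functor $A\mapsto \mathrm{Hom}_{k\text{-alg}}(A,\bar k)$ is an anti-equivalence from the category of difference locally étale $k$-algebras to the category of difference profinite $G$-sets. Here $\mathrm{Hom}_{k\text{-alg}}(A,\bar k)$ (homomorphisms of the underlying $k$-algebras) has the topology of pointwise convergence, the action of $G$ by composition and the self-map $f\mapsto f^\sigma$ determined by $\bar\sigma\circ f^\sigma=f\circ\sigma_A$. Every finitely $\sigma$-presented étale $k$-algebra is difference locally étale, and the anti-equivalence restricts to anti-equivalences of the following full subcategories: 1. finitely $\sigma$-generated étale $k$-algebras and finitely $\sigma$-generated difference profinite $G$-sets; 2. finitely $\sigma$-presented étale $k$-algebras and finitely $\sigma$-presented difference profinite $G$-sets. -/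

import Mathlib

open CategoryTheory TensorProduct

universe u

namespace DiffGal

/-! ### Difference algebras over a difference field `(k, σ)` -/

/-- A difference algebra over the difference ring `(k, σ)`: a commutative `k`-algebra with a ring
endomorphism that extends `σ`. -/
structure DiffAlg {k : Type u} [Field k] (σ : k →+* k) where
  carrier : Type u
  [commRing : CommRing carrier]
  [algebra : Algebra k carrier]
  shift : carrier →+* carrier
  shift_algebraMap : ∀ c : k, shift (algebraMap k carrier c) = algebraMap k carrier (σ c)

namespace DiffAlg

variable {k : Type u} [Field k] {σ : k →+* k}

instance : CoeSort (DiffAlg σ) (Type u) := ⟨carrier⟩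

instance (A : DiffAlg σ) : CommRing A := A.commRing

instance (A : DiffAlg σ) : Algebra k A := A.algebra

/-- Homomorphisms of difference algebras: `k`-algebra homomorphisms commuting with the shifts. -/
@[ext]
structure Hom (A B : DiffAlg σ) where
  toAlgHom : A →ₐ[k] B
  map_shift : ∀ a : A, toAlgHom (A.shift a) = B.shift (toAlgHom a)

instance : Category (DiffAlg σ) where
  Hom A B := Hom A B
  id A := ⟨AlgHom.id k A, fun _ => rfl⟩
  comp f g := ⟨g.toAlgHom.comp f.toAlgHom, fun a => by
    simp [f.map_shift, g.map_shift]⟩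

/-- `ι : A₀ → B` exhibits the difference algebra `B` as the free difference algebra `[A₀]_σ` on the
`k`-algebra `A₀`: it is the universal arrow for the left adjoint of the functor that forgets the
shift. -/
def IsFree (A₀ : Type u) [CommRing A₀] [Algebra k A₀] (B : DiffAlg σ) (ι : A₀ →ₐ[k] B) : Prop :=
  ∀ (D : DiffAlg σ) (f : A₀ →ₐ[k] D), ∃! h : B ⟶ D, h.toAlgHom.comp ι = f

/-- A cocorrespondence `A₀ → C₀ ← A₀` of `k`-algebras: the left arrow is `k`-linear and the right
arrow is linear over `σ : k → k`. -/
structure Cocorr {k : Type u} [Field k] (σ : k →+* k) where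
  A₀ : Type u
  C₀ : Type u
  [commRingA : CommRing A₀]
  [algebraA : Algebra k A₀]
  [commRingC : CommRing C₀]
  [algebraC : Algebra k C₀]
  p : A₀ →ₐ[k] C₀
  s : A₀ →+* C₀
  s_algebraMap : ∀ c : k, s (algebraMap k A₀ c) = algebraMap k C₀ (σ c)

attribute [instance] Cocorr.commRingA Cocorr.algebraA Cocorr.commRingC Cocorr.algebraC

/-- A morphism of cocorrespondences from `Q` to the cocorrespondence `D = D ← D`, with arrows the
identity and the shift, underlying a difference algebra `D`. -/
structure Cocorr.HomTo (Q : Cocorr σ) (D : DiffAlg σ) where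
  f₀ : Q.A₀ →ₐ[k] D
  f₁ : Q.C₀ →ₐ[k] D
  comm_p : ∀ a, f₁ (Q.p a) = f₀ a
  comm_s : ∀ a, f₁ (Q.s a) = D.shift (f₀ a)

/-- `v` exhibits `B` as the difference algebra `[A₀; C₀]_σ` directly presented by `Q`: it is the
universal arrow for the left adjoint of the functor from difference algebras to
cocorrespondences. -/
def IsDirectlyPresented (Q : Cocorr σ) (B : DiffAlg σ) (v : Q.HomTo B) : Prop :=
  ∀ (D : DiffAlg σ) (w : Q.HomTo D),
    ∃! h : B ⟶ D, h.toAlgHom.comp v.f₀ = w.f₀ ∧ h.toAlgHom.comp v.f₁ = w.f₁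

end DiffAlg

/-! ### Difference profinite sets with an action of a difference group `(G, φ)` -/

section Prof

variable {G : Type u} [Group G] [TopologicalSpace G] {φ : G →ₜ* G}

/-- A difference profinite set with an action of the difference topological group `(G, φ)`: a
profinite space with a continuous `G`-action and a continuous self-map `shift` such that
`shift (g • x) = φ g • shift x`. -/
structure DiffGProf (φ : G →ₜ* G) where
  carrier : Type u
  [top : TopologicalSpace carrier]
  [compact : CompactSpace carrier]
  [t2 : T2Space carrier]
  [totallyDisconnected : TotallyDisconnectedSpace carrier]
  [mulAction : MulAction G carrier]
  [continuousSMul : ContinuousSMul G carrier]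
  shift : carrier → carrier
  continuous_shift : Continuous shift
  shift_smul : ∀ (g : G) (x : carrier), shift (g • x) = φ g • shift x

namespace DiffGProf

instance : CoeSort (DiffGProf φ) (Type u) := ⟨carrier⟩

instance (X : DiffGProf φ) : TopologicalSpace X := X.top

instance (X : DiffGProf φ) : CompactSpace X := X.compact

instance (X : DiffGProf φ) : T2Space X := X.t2

instance (X : DiffGProf φ) : TotallyDisconnectedSpace X := X.totallyDisconnected

instance (X : DiffGProf φ) : MulAction G X := X.mulAction

instance (X : DiffGProf φ) : ContinuousSMul G X := X.continuousSMul

/-- Morphisms: continuous equivariant maps commuting with the shifts. -/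
@[ext]
structure Hom (X Y : DiffGProf φ) where
  toFun : X → Y
  continuous_toFun : Continuous toFun
  map_smul : ∀ (g : G) (x : X), toFun (g • x) = g • toFun x
  map_shift : ∀ x : X, toFun (X.shift x) = Y.shift (toFun x)

instance : Category (DiffGProf φ) where
  Hom X Y := Hom X Y
  id X := ⟨id, continuous_id, fun _ _ => rfl, fun _ => rfl⟩
  comp f g := ⟨g.toFun ∘ f.toFun, g.continuous_toFun.comp f.continuous_toFun,
    fun a x => by simp [f.map_smul, g.map_smul], fun x => by simp [f.map_shift, g.map_shift]⟩

/-- The sequences `∏ i : ℕ, X₀`, where `G` acts on the `i`-th factor through `φ^i`. -/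
def TwistedSeq (_φ : G →ₜ* G) (X₀ : Type u) : Type u := ℕ → X₀

instance (X₀ : Type u) [TopologicalSpace X₀] : TopologicalSpace (TwistedSeq φ X₀) :=
  inferInstanceAs (TopologicalSpace (ℕ → X₀))

instance (X₀ : Type u) [TopologicalSpace X₀] [CompactSpace X₀] :
    CompactSpace (TwistedSeq φ X₀) :=
  inferInstanceAs (CompactSpace (ℕ → X₀))

instance (X₀ : Type u) [TopologicalSpace X₀] [T2Space X₀] : T2Space (TwistedSeq φ X₀) :=
  inferInstanceAs (T2Space (ℕ → X₀))

instance (X₀ : Type u) [TopologicalSpace X₀] [TotallyDisconnectedSpace X₀] :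
    TotallyDisconnectedSpace (TwistedSeq φ X₀) :=
  inferInstanceAs (TotallyDisconnectedSpace (ℕ → X₀))

instance (X₀ : Type u) [MulAction G X₀] : MulAction G (TwistedSeq φ X₀) where
  smul g x := fun i => (φ^[i] g) • x i
  one_smul x := funext fun i => by
    change (φ^[i] 1) • x i = x i
    rw [iterate_map_one, one_smul]
  mul_smul g h x := funext fun i => by
    change (φ^[i] (g * h)) • x i = (φ^[i] g) • (φ^[i] h) • x i
    rw [iterate_map_mul, mul_smul]

instance (X₀ : Type u) [TopologicalSpace X₀] [MulAction G X₀] [ContinuousSMul G X₀] :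
    ContinuousSMul G (TwistedSeq φ X₀) where
  continuous_smul := continuous_pi fun i => by
    change Continuous fun q : G × (ℕ → X₀) => (φ^[i] q.1) • q.2 i
    exact ((φ.continuous_toFun.iterate i).comp continuous_fst).smul
      ((continuous_apply i).comp continuous_snd)

/-- The freely generated difference `G`-profinite set `[X₀]^σ_G` on a finite discrete `G`-set `X₀`:
the sequences in `X₀` with the left shift, `G` acting on the `i`-th factor through `φ^i`. -/
def free (φ : G →ₜ* G) (X₀ : Type u) [Finite X₀] [TopologicalSpace X₀] [DiscreteTopology X₀]
    [MulAction G X₀] [ContinuousSMul G X₀] : DiffGProf φ where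
  carrier := TwistedSeq φ X₀
  shift x := fun i => x (i + 1)
  continuous_shift := continuous_pi fun i => continuous_apply (A := fun _ : ℕ => X₀) (i + 1)
  shift_smul _ _ := rfl

/-- Finitely freely generated: isomorphic to `free φ X₀` for a finite discrete set `X₀` with a
continuous action of `G`. -/
def IsFinFree (X : DiffGProf φ) : Prop :=
  ∃ (X₀ : Type u) (_ : Finite X₀) (_ : TopologicalSpace X₀) (_ : DiscreteTopology X₀)
    (_ : MulAction G X₀) (_ : ContinuousSMul G X₀), Nonempty (X ≅ free φ X₀)

/-- Finitely generated: a subobject of a finitely freely generated object. -/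
def IsFinGen (X : DiffGProf φ) : Prop :=
  ∃ (Y : DiffGProf φ) (i : X ⟶ Y), Y.IsFinFree ∧ Mono i

/-- Finitely presented: an equaliser of a pair of morphisms between two finitely freely generated
objects. -/
def IsFinPres (X : DiffGProf φ) : Prop :=
  ∃ (Y Z : DiffGProf φ) (f g : Y ⟶ Z) (i : X ⟶ Y) (w : i ≫ f = i ≫ g),
    Y.IsFinFree ∧ Z.IsFinFree ∧ Nonempty (Limits.IsLimit (Limits.Fork.ofι i w))

end DiffGProf

end Prof

/-! ### The Galois correspondence for a separable closure `(K, τ)` of a difference field `(k, σ)` -/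

section Galois

variable {k K : Type u} [Field k] [Field K] [Algebra k K] {σ : k →+* k} {τ : K →+* K}

/-- `A` is difference locally étale, i.e. split by `K`: `K ⊗[k] A`, with the shift `τ ⊗ σ_A`, is
isomorphic as a difference `K`-algebra to the algebra of continuous functions from some difference
profinite set `(X, t)` to the discrete field `K`, with the shift `f ↦ τ ∘ f ∘ t`. (The shifts are
compared on pure tensors, which generate the tensor product additively.) -/
def IsLocEtale (τ : K →+* K) (A : DiffAlg σ) : Prop :=
  ∃ (X : Type u) (_ : TopologicalSpace X) (_ : CompactSpace X) (_ : T2Space X)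
    (_ : TotallyDisconnectedSpace X) (t : X → X) (_ : Continuous t)
    (e : (K ⊗[k] A) ≃ₐ[K] LocallyConstant X K),
    ∀ (c : K) (a : A) (x : X), e (τ c ⊗ₜ[k] A.shift a) x = τ (e (c ⊗ₜ[k] a) (t x))

/-- The category of difference locally étale algebras over `(k, σ)`, a full subcategory of the
category of difference algebras. -/
abbrev LocEtaleAlg (σ : k →+* k) (τ : K →+* K) :=
  ObjectProperty.FullSubcategory (fun A : DiffAlg σ => IsLocEtale τ A)

/-- Finitely generated étale: difference locally étale, and a quotient of the free difference
algebra on some (finitely generated) étale `k`-algebra. -/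
def IsFinGenEtale (τ : K →+* K) (A : DiffAlg σ) : Prop :=
  IsLocEtale τ A ∧
    ∃ (A₀ : Type u) (_ : CommRing A₀) (_ : Algebra k A₀) (_ : Algebra.Etale k A₀)
      (B : DiffAlg σ) (ι : A₀ →ₐ[k] B) (q : B ⟶ A),
      DiffAlg.IsFree A₀ B ι ∧ Function.Surjective q.toAlgHom

/-- Finitely presented étale: isomorphic to `[A₀; C₀]_σ` for some cocorrespondence of étale
`k`-algebras. -/
def IsFinPresEtale (A : DiffAlg σ) : Prop :=
  ∃ (Q : DiffAlg.Cocorr σ) (v : Q.HomTo A),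
    Algebra.Etale k Q.A₀ ∧ Algebra.Etale k Q.C₀ ∧ DiffAlg.IsDirectlyPresented Q A v

/-- Given `f : A → K` whose composite with the shift of `A` takes values in the range of `τ`, the
unique algebra homomorphism `f^σ : A → K` with `τ ∘ f^σ = f ∘ σ_A`. -/
noncomputable def twist (hτ : ∀ c : k, τ (algebraMap k K c) = algebraMap k K (σ c))
    (A : DiffAlg σ) (f : A →ₐ[k] K) (h : ∀ a, ∃ y, τ y = f (A.shift a)) : A →ₐ[k] K where
  toFun a := (h a).choose
  map_one' := τ.injective (by rw [(h _).choose_spec]; simp)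
  map_mul' a b := τ.injective (by
    rw [map_mul τ]
    exact (h _).choose_spec.trans
      (by rw [map_mul, map_mul, (h a).choose_spec, (h b).choose_spec]))
  map_zero' := τ.injective (by rw [(h _).choose_spec]; simp)
  map_add' a b := τ.injective (by
    rw [map_add τ]
    exact (h _).choose_spec.trans
      (by rw [map_add, map_add, (h a).choose_spec, (h b).choose_spec]))
  commutes' c := τ.injective (by
    rw [(h _).choose_spec, A.shift_algebraMap, f.commutes, hτ])

theorem twist_spec (hτ : ∀ c : k, τ (algebraMap k K c) = algebraMap k K (σ c))
    (A : DiffAlg σ) (f : A →ₐ[k] K) (h : ∀ a, ∃ y, τ y = f (A.shift a)) (a : A) :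
    τ (twist hτ A f h a) = f (A.shift a) := (h a).choose_spec

/-! #### The difference Galois group -/

theorem exists_galois_lift [IsSepClosure k K]
    (hτ : ∀ c : k, τ (algebraMap k K c) = algebraMap k K (σ c)) (g : Gal(K/k)) (x : K) :
    ∃ y, τ y = g (τ x) := by
  have : IsGalois k K := inferInstance
  set p := minpoly k x with hp
  have hs : (p.map (algebraMap k K)).Splits := Normal.splits inferInstance x
  have hp0 : p.map (algebraMap k K) ≠ 0 :=
    (Polynomial.map_ne_zero_iff (algebraMap k K).injective).2
      (minpoly.ne_zero (Algebra.IsIntegral.isIntegral x))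
  have hroot : g (τ x) ∈ ((p.map (algebraMap k K)).map τ).roots := by
    rw [Polynomial.mem_roots ((Polynomial.map_ne_zero_iff τ.injective).2 hp0)]
    have h1 : (g : K →+* K).comp (τ.comp (algebraMap k K)) = τ.comp (algebraMap k K) := by
      ext c
      simp [hτ]
    rw [Polynomial.IsRoot, Polynomial.map_map, Polynomial.eval_map, ← h1]
    have := Polynomial.hom_eval₂ p (algebraMap k K) ((g : K →+* K).comp τ) x
    rw [RingHom.comp_assoc] at this
    have h2 : Polynomial.eval₂ (algebraMap k K) x p = 0 := minpoly.aeval k x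
    rw [h2] at this
    simpa using this.symm
  rw [hs.roots_map] at hroot
  obtain ⟨y, -, hy⟩ := Multiset.mem_map.1 hroot
  exact ⟨y, hy⟩

/-- The separable closure `K` as a difference algebra over `(k, σ)`. -/
def selfAlg (hτ : ∀ c : k, τ (algebraMap k K c) = algebraMap k K (σ c)) : DiffAlg σ where
  carrier := K
  shift := τ
  shift_algebraMap := hτ

/-- The automorphism `g^σ` with `τ ∘ g^σ = g ∘ τ`. -/
noncomputable def galTwist [IsSepClosure k K]
    (hτ : ∀ c : k, τ (algebraMap k K c) = algebraMap k K (σ c)) (g : Gal(K/k)) : Gal(K/k) :=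
  AlgEquiv.ofBijective
    (show K →ₐ[k] K from twist hτ (selfAlg hτ) (g : K →ₐ[k] K) (exists_galois_lift hτ g))
    (Algebra.IsAlgebraic.algHom_bijective _)

theorem galTwist_spec [IsSepClosure k K]
    (hτ : ∀ c : k, τ (algebraMap k K c) = algebraMap k K (σ c)) (g : Gal(K/k)) (x : K) :
    τ (galTwist hτ g x) = g (τ x) :=
  twist_spec hτ (selfAlg hτ) (g : K →ₐ[k] K) (exists_galois_lift hτ g) x

theorem continuous_galTwist [IsSepClosure k K]
    (hτ : ∀ c : k, τ (algebraMap k K c) = algebraMap k K (σ c)) :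
    Continuous (galTwist (K := K) hτ) := by
  have : IsGalois k K := inferInstance
  let ψ : Gal(K/k) →* Gal(K/k) :=
    { toFun := galTwist hτ
      map_one' := AlgEquiv.ext fun x => τ.injective (by rw [galTwist_spec]; rfl)
      map_mul' := fun g h => AlgEquiv.ext fun x => τ.injective (by
        rw [galTwist_spec, AlgEquiv.mul_apply, AlgEquiv.mul_apply, galTwist_spec, galTwist_spec]) }
  refine continuous_of_continuousAt_one ψ ?_
  rw [ContinuousAt, map_one]
  intro s hs
  obtain ⟨E, hE, hEs⟩ := (krullTopology_mem_nhds_one_iff k K s).1 hs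
  obtain ⟨S, hS⟩ := (inferInstance : Module.Finite k E).fg_top
  have hU : (⋂ x ∈ S, (MulAction.stabilizer Gal(K/k) (τ (x : K)) : Set Gal(K/k))) ∈
      nhds (1 : Gal(K/k)) :=
    (Filter.biInter_finset_mem S).2 fun x _ =>
      (stabilizer_isOpen_of_isIntegral (τ (x : K))).mem_nhds (one_mem _)
  refine Filter.mem_map.2 (Filter.mem_of_superset hU fun g hg => hEs ?_)
  refine (IntermediateField.mem_fixingSubgroup_iff E (ψ g)).2 fun x hx => ?_
  have key : ((ψ g : K ≃ₐ[k] K).toLinearMap.comp E.val.toLinearMap) = E.val.toLinearMap := by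
    refine LinearMap.ext_on hS fun y hy => τ.injective ?_
    have h1 : g (τ (y : K)) = τ (y : K) := by
      have := Set.mem_iInter₂.1 hg y hy
      exact MulAction.mem_stabilizer_iff.1 this
    exact (galTwist_spec hτ g (y : K)).trans h1
  exact LinearMap.congr_fun key ⟨x, hx⟩

/-- The continuous endomorphism `g ↦ g^σ` that makes `Gal(K/k)` a difference profinite group. -/
noncomputable def galShift [IsSepClosure k K]
    (hτ : ∀ c : k, τ (algebraMap k K c) = algebraMap k K (σ c)) : Gal(K/k) →ₜ* Gal(K/k) where
  toFun := galTwist hτ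
  map_one' := AlgEquiv.ext fun x => τ.injective (by rw [galTwist_spec]; rfl)
  map_mul' g h := AlgEquiv.ext fun x => τ.injective (by
    rw [galTwist_spec, AlgEquiv.mul_apply, AlgEquiv.mul_apply, galTwist_spec, galTwist_spec])
  continuous_toFun := continuous_galTwist hτ

/-! #### The set of points of a difference locally étale algebra -/

/-- The set `Hom_k(A, K)`. -/
def Pts (K : Type u) [Field K] [Algebra k K] (A : DiffAlg σ) : Type u := A →ₐ[k] K

/-- A point as an algebra homomorphism. -/
abbrev Pts.hom {A : DiffAlg σ} (f : Pts K A) : A →ₐ[k] K := f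

/-- The topology of pointwise convergence on `Hom_k(A, K)`, the field `K` being discrete. -/
instance (A : DiffAlg σ) : TopologicalSpace (Pts K A) :=
  TopologicalSpace.induced (fun (f : A →ₐ[k] K) (a : A) => f a)
    (@Pi.topologicalSpace A (fun _ => K) (fun _ => ⊥))

/-- The Galois group acts on `Hom_k(A, K)` by composition. -/
instance (A : DiffAlg σ) : MulAction Gal(K/k) (Pts K A) where
  smul g f := (g : K →ₐ[k] K).comp f
  one_smul _ := rfl
  mul_smul _ _ _ := rfl

theorem mem_range_of_isLocEtale {A : DiffAlg σ} {X : Type u} [TopologicalSpace X]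
    (e : (K ⊗[k] A) ≃ₐ[K] LocallyConstant X K) (f : A →ₐ[k] K) (a : A) :
    ∃ x, e (1 ⊗ₜ[k] a) x = f a := by
  by_contra hcon
  push Not at hcon
  let F : (K ⊗[k] A) →ₐ[K] K :=
    Algebra.TensorProduct.lift (AlgHom.id K K) f (fun _ _ => Commute.all _ _)
  let ψ : LocallyConstant X K →ₐ[K] K := F.comp e.symm.toAlgHom
  set q : LocallyConstant X K := e (1 ⊗ₜ[k] a) with hq
  have hψ : ψ q = f a := by
    simp [ψ, F, hq]
  let r : LocallyConstant X K := q - algebraMap K _ (f a)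
  have hr : ψ r = 0 := by
    simp only [r, map_sub, hψ, AlgHom.commutes]
    simp
  have hu : r * r.map (fun y => y⁻¹) = 1 := by
    ext x
    have : r x ≠ 0 := sub_ne_zero.2 (hcon x)
    simp [this]
  have := congrArg ψ hu
  rw [map_mul, hr, zero_mul, map_one] at this
  exact zero_ne_one this

theorem exists_point_lift {A : DiffAlg σ} (hA : IsLocEtale τ A) (f : A →ₐ[k] K) (a : A) :
    ∃ y, τ y = f (A.shift a) := by
  obtain ⟨X, _, _, _, _, t, _, e, he⟩ := hA
  obtain ⟨x, hx⟩ := mem_range_of_isLocEtale e f (A.shift a)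
  have := he 1 a x
  rw [map_one, hx] at this
  exact ⟨_, this.symm⟩

theorem finite_values {A : DiffAlg σ} (hA : IsLocEtale τ A) (a : A) :
    {y : K | ∃ f : A →ₐ[k] K, f a = y}.Finite := by
  obtain ⟨X, _, _, _, _, t, _, e, he⟩ := hA
  refine (e (1 ⊗ₜ[k] a)).range_finite.subset ?_
  rintro y ⟨f, rfl⟩
  exact mem_range_of_isLocEtale e f a

theorem isClosedEmbedding_eval (A : DiffAlg σ) :
    letI : TopologicalSpace K := ⊥
    Topology.IsClosedEmbedding (fun (f : Pts K A) (a : A) => f.hom a) := by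
  let : TopologicalSpace K := ⊥
  have : DiscreteTopology K := ⟨rfl⟩
  refine ⟨⟨⟨rfl⟩, fun f g h => AlgHom.ext fun a => congrFun h a⟩, ?_⟩
  have hset : Set.range (fun (f : Pts K A) (a : A) => f.hom a) =
      {v : A → K | (∀ a b, v (a * b) = v a * v b) ∧ (∀ a b, v (a + b) = v a + v b) ∧
        ∀ c : k, v (algebraMap k A c) = algebraMap k K c} := by
    ext v
    constructor
    · rintro ⟨f, rfl⟩
      exact ⟨fun a b => map_mul f.hom a b,
        fun a b => map_add f.hom a b, fun c => AlgHom.commutes _ c⟩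
    · rintro ⟨hm, ha, hc⟩
      refine ⟨(show A →ₐ[k] K from
        { toFun := v
          map_one' := by simpa using hc 1
          map_mul' := hm
          map_zero' := by simpa using hc 0
          map_add' := ha
          commutes' := hc }), rfl⟩
  rw [hset]
  have hcont (a : A) : Continuous fun v : A → K => v a := continuous_apply a
  refine IsClosed.inter (s₁ := {v : A → K | ∀ a b, v (a * b) = v a * v b}) ?_
    (IsClosed.inter (s₁ := {v : A → K | ∀ a b, v (a + b) = v a + v b}) ?_ ?_)
  · simp only [Set.ofPred_forall]
    exact isClosed_iInter fun a => isClosed_iInter fun b => isClosed_eq (hcont _)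
      ((continuous_of_discreteTopology (f := fun q : K × K => q.1 * q.2)).comp
        ((hcont a).prodMk (hcont b)))
  · simp only [Set.ofPred_forall]
    exact isClosed_iInter fun a => isClosed_iInter fun b => isClosed_eq (hcont _)
      ((continuous_of_discreteTopology (f := fun q : K × K => q.1 + q.2)).comp
        ((hcont a).prodMk (hcont b)))
  · change IsClosed {v : A → K | ∀ c : k, v (algebraMap k A c) = algebraMap k K c}
    simp only [Set.ofPred_forall]
    exact isClosed_iInter fun c => isClosed_eq (hcont _) continuous_const

theorem compactSpace_pts {A : DiffAlg σ} (hA : IsLocEtale τ A) : CompactSpace (Pts K A) := by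
  let : TopologicalSpace K := ⊥
  have : DiscreteTopology K := ⟨rfl⟩
  have h := isClosedEmbedding_eval (K := K) A
  have hc : IsCompact (Set.univ.pi fun a : A => {y : K | ∃ f : A →ₐ[k] K, f a = y}) :=
    isCompact_univ_pi fun a => (finite_values hA a).isCompact
  refine ⟨?_⟩
  exact (h.isCompact_preimage hc).of_isClosed_subset isClosed_univ fun f _ =>
    Set.mem_preimage.2 (Set.mem_univ_pi.2 fun a => Exists.intro f.hom rfl)

theorem t2Space_pts (A : DiffAlg σ) : T2Space (Pts K A) := by
  let : TopologicalSpace K := ⊥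
  have : DiscreteTopology K := ⟨rfl⟩
  exact (isClosedEmbedding_eval (K := K) A).isEmbedding.t2Space

theorem totallyDisconnectedSpace_pts (A : DiffAlg σ) : TotallyDisconnectedSpace (Pts K A) := by
  let : TopologicalSpace K := ⊥
  have : DiscreteTopology K := ⟨rfl⟩
  exact (isClosedEmbedding_eval (K := K) A).isEmbedding.isTotallyDisconnected_range.1
    (isTotallyDisconnected_of_totallyDisconnectedSpace _)

theorem continuousSMul_pts [IsSepClosure k K] (A : DiffAlg σ) :
    ContinuousSMul Gal(K/k) (Pts K A) := by
  let : TopologicalSpace K := ⊥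
  have : DiscreteTopology K := ⟨rfl⟩
  have : IsGalois k K := inferInstance
  have hsm : ContinuousSMul Gal(K/k) K :=
    continuousSMul_iff_stabilizer_isOpen.2 fun x => stabilizer_isOpen_of_isIntegral x
  have h := isClosedEmbedding_eval (K := K) A
  refine ⟨h.isInducing.continuous_iff.2 (continuous_pi fun a => ?_)⟩
  change Continuous fun q : Gal(K/k) × Pts K A => q.1 • (Pts.hom q.2) a
  exact continuous_fst.smul (((continuous_apply a).comp h.continuous).comp continuous_snd)

/-- The shift `f ↦ f^σ` on `Hom_k(A, K)`, characterised by `τ ∘ f^σ = f ∘ σ_A`. -/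
noncomputable def ptsShift (hτ : ∀ c : k, τ (algebraMap k K c) = algebraMap k K (σ c))
    {A : DiffAlg σ} (hA : IsLocEtale τ A) (f : Pts K A) : Pts K A :=
  twist hτ A f (exists_point_lift hA f)

theorem ptsShift_spec (hτ : ∀ c : k, τ (algebraMap k K c) = algebraMap k K (σ c))
    {A : DiffAlg σ} (hA : IsLocEtale τ A) (f : A →ₐ[k] K) (a : A) :
    τ ((ptsShift hτ hA f).hom a) = f (A.shift a) :=
  twist_spec hτ A f (exists_point_lift hA f) a

theorem continuous_ptsShift (hτ : ∀ c : k, τ (algebraMap k K c) = algebraMap k K (σ c))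
    {A : DiffAlg σ} (hA : IsLocEtale τ A) : Continuous (ptsShift hτ hA) := by
  let : TopologicalSpace K := ⊥
  have : DiscreteTopology K := ⟨rfl⟩
  have h := isClosedEmbedding_eval (K := K) A
  refine h.isInducing.continuous_iff.2 (continuous_pi fun a => ?_)
  have h1 : Continuous fun f : Pts K A => f.hom (A.shift a) :=
    (continuous_apply (A.shift a)).comp h.continuous
  have h2 : (fun f : Pts K A => (ptsShift hτ hA f).hom a) =
      (fun y => Function.invFun τ y) ∘
        fun f : Pts K A => f.hom (A.shift a) := by
    funext f
    rw [Function.comp_apply, ← ptsShift_spec hτ hA f a]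
    exact (Function.leftInverse_invFun τ.injective _).symm
  change Continuous fun f : Pts K A => (ptsShift hτ hA f).hom a
  rw [h2]
  exact continuous_of_discreteTopology.comp h1

/-- The functor `A ↦ (Hom_k(A, K), f ↦ f^σ)` from difference locally étale algebras to difference
profinite `Gal(K/k)`-sets. -/
noncomputable def galFunctor [IsSepClosure k K]
    (hτ : ∀ c : k, τ (algebraMap k K c) = algebraMap k K (σ c)) :
    (LocEtaleAlg σ τ)ᵒᵖ ⥤ DiffGProf (galShift (K := K) hτ) where
  obj A :=
    { carrier := Pts K A.unop.obj
      compact := compactSpace_pts A.unop.property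
      t2 := t2Space_pts _
      totallyDisconnected := totallyDisconnectedSpace_pts _
      continuousSMul := continuousSMul_pts _
      shift := ptsShift hτ A.unop.property
      continuous_shift := continuous_ptsShift hτ _
      shift_smul := fun g f => AlgHom.ext fun a => τ.injective <| by
        refine (ptsShift_spec hτ A.unop.property (g • f) a).trans ?_
        refine Eq.trans ?_ (galTwist_spec hτ g _).symm
        exact congrArg g (ptsShift_spec hτ A.unop.property f a).symm }
  map {A B} h :=
    { toFun := fun f => AlgHom.comp f.hom h.unop.hom.toAlgHom
      continuous_toFun := by
        let : TopologicalSpace K := ⊥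
        have hA := isClosedEmbedding_eval (K := K) A.unop.obj
        have hB := isClosedEmbedding_eval (K := K) B.unop.obj
        exact hB.isInducing.continuous_iff.2 (continuous_pi fun b =>
          (continuous_apply (h.unop.hom.toAlgHom b)).comp hA.continuous)
      map_smul := fun _ _ => rfl
      map_shift := fun f => AlgHom.ext fun b => τ.injective <| by
        refine (ptsShift_spec hτ A.unop.property f _).trans ?_
        refine Eq.trans ?_ (ptsShift_spec hτ B.unop.property _ b).symm
        exact congrArg f.hom (h.unop.hom.map_shift b).symm }

end Galois

/-- The functor `F` restricts to an equivalence between the full subcategories of objects satisfying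
`P` and of objects satisfying `Q`. -/
def RestrictsToEquivalence {C : Type*} [Category C] {D : Type*} [Category D] (F : C ⥤ D)
    (P : ObjectProperty C) (Q : ObjectProperty D) : Prop :=
  ∃ h : ∀ X : P.FullSubcategory, Q ((P.ι ⋙ F).obj X), (Q.lift (P.ι ⋙ F) h).IsEquivalence

end DiffGal

/-! Two facts over `K` carry the proof. In a `K`-algebra generated by elements that are killed by
products of distinct linear factors, the `K`-points detect zero (`eq_zero_of_forall_point`); and a
subalgebra of locally constant functions on a compact space that separates points is everything
(`subalgebra_eq_top_of_separates`). So if `A` is generated by split elements, `K ⊗ A` is the algebra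
of locally constant functions on `Hom_k(A, K)`. Splitness also forces `f ∘ σ_A` to take values in
the range of `τ`, so `f^σ` exists although `τ` need not be surjective.

The quasi-inverse sends `X` to the algebra `eqv k K X` of equivariant locally constant functions,
with shift `φ ↦ τ ∘ φ ∘ σ_X`. Galois descent (`lcExtend_eqv_bijective`) identifies `K ⊗ eqv k K X`
with all locally constant functions: injectivity is Artin's argument, surjectivity the separation of
points by equivariant functions. Faithful flatness of `K` over `k` then returns from `K ⊗ A` to `A`.

Finite generation: if the shift iterates of the image of an étale algebra `A₀` generate `A`, the
points of `A` embed into the sequences of points of `A₀`; conversely, an embedding into a free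
object yields generators, because a subalgebra that separates points is everything.

Finite presentation: the points of `[A₀; C₀]_σ` are the sequences `e` of points of `C₀` with `e i ∘
s = τ ∘ e (i + 1) ∘ p`, an equaliser of maps between free objects. Conversely, continuity makes such
an equaliser a subshift of finite type: the sequences all of whose windows of a fixed length lie in
a finite set `E`. The maps "drop the last entry" and "drop the first entry" on `E` give the
cocorrespondence. -/

namespace DiffGal

section

/-! ### Split algebras over `K` and locally constant functions -/

section Split

/-- Two ring homomorphisms `f : K → R` and `g : A → R` that agree on `k` induce a ring homomorphism
`K ⊗[k] A → R`. -/
theorem exists_tensor_lift {k K A R : Type*} [CommRing k] [CommRing K] [Algebra k K] [CommRing A]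
    [Algebra k A] [CommRing R] (f : K →+* R) (g : A →+* R)
    (h : ∀ c : k, f (algebraMap k K c) = g (algebraMap k A c)) :
    ∃ F : K ⊗[k] A →+* R, ∀ c a, F (c ⊗ₜ[k] a) = f c * g a := by
  let : Algebra k R := (f.comp (algebraMap k K)).toAlgebra
  let f' : K →ₐ[k] R := { f with commutes' := fun _ => rfl }
  let g' : A →ₐ[k] R := { g with commutes' := fun c => (h c).symm }
  refine ⟨(Algebra.TensorProduct.lift f' g' fun _ _ => Commute.all _ _ : K ⊗[k] A →ₐ[k] R), ?_⟩
  intro c a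
  exact Algebra.TensorProduct.lift_tmul f' g' (fun _ _ => Commute.all _ _) c a

/-- `r` is annihilated by a product of distinct linear factors over `K`. -/
def IsSplitElt (K : Type*) {R : Type*} [CommRing K] [CommRing R] [Algebra K R] (r : R) : Prop :=
  ∃ s : Finset K, ∏ y ∈ s, (r - algebraMap K R y) = 0

variable {K R : Type*} [Field K] [CommRing R] [Algebra K R]

theorem IsSplitElt.of_injective {S : Type*} [CommRing S] [Algebra K S] (e : R →ₐ[K] S)
    (he : Function.Injective e) {r : R} (h : IsSplitElt K (e r)) : IsSplitElt K r := by
  obtain ⟨s, hs⟩ := h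
  refine ⟨s, he ?_⟩
  rw [map_zero, map_prod, ← hs]
  exact Finset.prod_congr rfl fun y _ => by simp

theorem isSplitElt_of_finite_range {X : Type*} [TopologicalSpace X] (φ : LocallyConstant X K)
    (h : (Set.range φ).Finite) : IsSplitElt K φ := by
  refine ⟨h.toFinset, LocallyConstant.ext fun x => ?_⟩
  change LocallyConstant.evalₐ K x _ = _
  rw [map_prod]
  exact Finset.prod_eq_zero (i := φ x) (by simp) (by simp [LocallyConstant.evalₐ])

/-- In a `K`-algebra generated by split elements, an element that vanishes at all `K`-points
is zero. -/
theorem eq_zero_of_forall_point {T : Set R} (hT : Algebra.adjoin K T = ⊤)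
    (hs : ∀ t ∈ T, IsSplitElt K t) {z : R} (hz : ∀ f : R →ₐ[K] K, f z = 0) : z = 0 := by
  classical
  by_contra hne
  -- The annihilator of `z`, proper because `z ≠ 0`.
  let I : Ideal R := LinearMap.ker (LinearMap.mulRight R z)
  have hI : I ≠ ⊤ := fun h => hne <| by
    have : (1 : R) ∈ I := h ▸ Submodule.mem_top
    simpa [I] using this
  obtain ⟨m, hm, hIm⟩ := Ideal.exists_le_maximal I hI
  -- The residue field is `K`: in the field `R ⧸ m` a generator is a root of a product of linear
  -- factors over `K`, so it lies in `K`.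
  have hbij : Function.Bijective (algebraMap K (R ⧸ m)) := by
    refine ⟨(algebraMap K (R ⧸ m)).injective, fun q => ?_⟩
    obtain ⟨r, rfl⟩ := Ideal.Quotient.mk_surjective q
    have hr : r ∈ ((Algebra.ofId K (R ⧸ m)).range).comap (Ideal.Quotient.mkₐ K m) := by
      have hle : Algebra.adjoin K T ≤
          ((Algebra.ofId K (R ⧸ m)).range).comap (Ideal.Quotient.mkₐ K m) := by
        refine Algebra.adjoin_le fun t ht => ?_
        obtain ⟨s, hs⟩ := hs t ht
        have := congrArg (Ideal.Quotient.mk m) hs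
        rw [map_prod, map_zero, Finset.prod_eq_zero_iff] at this
        obtain ⟨y, -, hy⟩ := this
        refine ⟨y, ?_⟩
        rw [map_sub, sub_eq_zero] at hy
        exact hy.symm
      exact hle (hT ▸ Algebra.mem_top)
    obtain ⟨y, hy⟩ := hr
    exact ⟨y, hy⟩
  let f : R →ₐ[K] K := (AlgEquiv.ofBijective (Algebra.ofId K (R ⧸ m)) hbij).symm.toAlgHom.comp
    (Ideal.Quotient.mkₐ K m)
  have hf : ∀ r, f r = 0 ↔ r ∈ m := fun r => by
    simp [f, Ideal.Quotient.eq_zero_iff_mem]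
  -- The elements that agree with their value at `f` in the localisation at `m`. Once `z` is among
  -- them, some `v` outside `m` kills `z`, although the annihilator lies in `m`.
  let S : Subalgebra K R :=
    { carrier := {r | ∃ v, f v ≠ 0 ∧ v * (r - algebraMap K R (f r)) = 0}
      mul_mem' := by
        rintro a b ⟨v, hv, ha⟩ ⟨w, hw, hb⟩
        refine ⟨v * w, by simp [hv, hw], ?_⟩
        rw [map_mul, map_mul]
        linear_combination (w * b) * ha + (v * algebraMap K R (f a)) * hb
      add_mem' := by
        rintro a b ⟨v, hv, ha⟩ ⟨w, hw, hb⟩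
        refine ⟨v * w, by simp [hv, hw], ?_⟩
        rw [map_add, map_add]
        linear_combination w * ha + v * hb
      algebraMap_mem' := fun c => ⟨1, by simp, by simp⟩ }
  have hS : Algebra.adjoin K T ≤ S := by
    refine Algebra.adjoin_le fun t ht => ?_
    obtain ⟨s, hs⟩ := hs t ht
    have hmem : f t ∈ s := by
      have := congrArg f hs
      rw [map_prod, map_zero, Finset.prod_eq_zero_iff] at this
      obtain ⟨y, hys, hy⟩ := this
      rw [map_sub, sub_eq_zero, AlgHom.commutes] at hy
      exact hy ▸ hys
    -- The remaining factors are nonzero at `f` because the roots are distinct.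
    refine ⟨∏ y ∈ s.erase (f t), (t - algebraMap K R y), ?_, ?_⟩
    · rw [map_prod, Finset.prod_ne_zero_iff]
      intro y hy
      rw [map_sub, AlgHom.commutes]
      exact sub_ne_zero.2 (Finset.ne_of_mem_erase hy).symm
    · rw [Finset.prod_erase_mul _ _ hmem, hs]
  obtain ⟨v, hv, h0⟩ : z ∈ S := hS (hT ▸ Algebra.mem_top)
  rw [hz f, map_zero, sub_zero] at h0
  exact hv ((hf v).2 (hIm (by simpa [I] using h0)))

@[simp]
theorem locallyConstant_add_apply {X : Type*} [TopologicalSpace X] (φ ψ : LocallyConstant X K)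
    (x : X) : (φ + ψ) x = φ x + ψ x := rfl

@[simp]
theorem locallyConstant_sub_apply {X : Type*} [TopologicalSpace X] (φ ψ : LocallyConstant X K)
    (x : X) : (φ - ψ) x = φ x - ψ x := rfl

@[simp]
theorem locallyConstant_algebraMap_apply {X F : Type*} [TopologicalSpace X] [CommRing F]
    [Algebra F K] (c : F) (x : X) :
    algebraMap F (LocallyConstant X K) c x = algebraMap F K c := rfl

variable {X : Type*} [TopologicalSpace X] [CompactSpace X]

/-- A Stone–Weierstrass theorem for locally constant functions. -/
theorem subalgebra_eq_top_of_separates (S : Subalgebra K (LocallyConstant X K))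
    (hS : ∀ x y : X, x ≠ y → ∃ φ ∈ S, φ x ≠ φ y) : S = ⊤ := by
  refine eq_top_iff.2 fun φ _ => ?_
  -- A function that is 1 at `x` and supported on the level set of `φ` through `x`: a product over a
  -- finite cover of the complement.
  have hnear : ∀ x : X, ∃ h ∈ S, h x = 1 ∧ ∀ y, φ y ≠ φ x → h y = 0 := by
    intro x
    have hc : IsCompact {y | φ y ≠ φ x} :=
      (φ.isLocallyConstant {c | c = φ x}).isClosed_compl.isCompact
    refine hc.induction_on (p := fun C => ∃ h ∈ S, h x = 1 ∧ ∀ y ∈ C, h y = 0)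
      ⟨1, one_mem S, rfl, by simp⟩ ?_ ?_ ?_
    · rintro C D hCD ⟨h, hh, h1, h0⟩
      exact ⟨h, hh, h1, fun y hy => h0 y (hCD hy)⟩
    · rintro C D ⟨h, hh, h1, h0⟩ ⟨h', hh', h1', h0'⟩
      refine ⟨h * h', mul_mem hh hh', by simp [h1, h1'], ?_⟩
      rintro y (hy | hy)
      · simp [h0 y hy]
      · simp [h0' y hy]
    · intro y hy
      obtain ⟨ψ, hψ, hne⟩ := hS x y (fun h => hy (by rw [h]))
      have hne' := sub_ne_zero.2 hne
      let h : LocallyConstant X K := (ψ x - ψ y)⁻¹ • (ψ - algebraMap K _ (ψ y))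
      refine ⟨{z | h z = h y}, mem_nhdsWithin_of_mem_nhds
        ((h.isLocallyConstant {c | c = h y}).mem_nhds rfl), h,
        S.smul_mem (sub_mem hψ (S.algebraMap_mem _)) _, ?_, ?_⟩
      · simp [h, hne']
      · intro z hz
        rw [show h z = _ from hz]
        simp [h]
  -- The combination `h + h' - h * h'` is 1 wherever `h` or `h'` is, so the local functions glue to
  -- the constant 1, and `1 * φ ∈ S`.
  obtain ⟨h, -, hφ, h1⟩ : ∃ h ∈ S, h * φ ∈ S ∧ ∀ y ∈ (Set.univ : Set X), h y = 1 := by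
    refine isCompact_univ.induction_on
      (p := fun C => ∃ h ∈ S, h * φ ∈ S ∧ ∀ y ∈ C, h y = 1)
      ⟨0, zero_mem S, by simp, by simp⟩ ?_ ?_ ?_
    · rintro C D hCD ⟨h, hh, h1, h0⟩
      exact ⟨h, hh, h1, fun y hy => h0 y (hCD hy)⟩
    · rintro C D ⟨h, hh, h1, h0⟩ ⟨h', hh', h1', h0'⟩
      refine ⟨h + h' - h * h', sub_mem (add_mem hh hh') (mul_mem hh hh'), ?_, ?_⟩
      · rw [sub_mul, add_mul, mul_assoc]
        exact sub_mem (add_mem h1 h1') (mul_mem hh h1')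
      · rintro y (hy | hy)
        · simp [h0 y hy]
        · simp [h0' y hy]
    · intro x _
      obtain ⟨h, hh, h1, h0⟩ := hnear x
      refine ⟨{z | h z = h x}, mem_nhdsWithin_of_mem_nhds
        ((h.isLocallyConstant {c | c = h x}).mem_nhds rfl), h, hh, ?_, ?_⟩
      · have : h * φ = φ x • h := LocallyConstant.ext fun y => by
          by_cases hy : φ y = φ x
          · simp [hy, mul_comm]
          · simp [h0 y hy]
        rw [this]
        exact S.smul_mem hh _
      · intro z hz
        rw [show h z = _ from hz, h1]
  have : h = 1 := LocallyConstant.ext fun y => h1 y trivial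
  rwa [this, one_mul] at hφ

/-- The `K`-points of the algebra of locally constant functions on a compact space are
evaluations. -/
theorem exists_eq_eval (ψ : LocallyConstant X K →ₐ[K] K) : ∃ x, ∀ φ, ψ φ = φ x := by
  by_contra! hcon
  -- If `ψ` is no evaluation, its kernel contains near each point a function equal to 1 there; by
  -- compactness it contains 1.
  obtain ⟨h, h0, h1⟩ : ∃ h, ψ h = 0 ∧ ∀ y ∈ (Set.univ : Set X), h y = 1 := by
    refine isCompact_univ.induction_on (p := fun C => ∃ h, ψ h = 0 ∧ ∀ y ∈ C, h y = 1)
      ⟨0, map_zero ψ, by simp⟩ ?_ ?_ ?_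
    · rintro C D hCD ⟨h, h1, h0⟩
      exact ⟨h, h1, fun y hy => h0 y (hCD hy)⟩
    · rintro C D ⟨h, h1, h0⟩ ⟨h', h1', h0'⟩
      refine ⟨h + h' - h * h', by simp [h1, h1'], ?_⟩
      rintro y (hy | hy)
      · simp [h0 y hy]
      · simp [h0' y hy]
    · intro x _
      obtain ⟨φ, hφ⟩ := hcon x
      have hne := sub_ne_zero.2 hφ.symm
      let h : LocallyConstant X K := (φ x - ψ φ)⁻¹ • (φ - algebraMap K _ (ψ φ))
      refine ⟨{z | h z = h x}, mem_nhdsWithin_of_mem_nhds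
        ((h.isLocallyConstant {c | c = h x}).mem_nhds rfl), h, ?_, ?_⟩
      · simp only [h, map_smul, map_sub, AlgHom.commutes]
        simp
      · intro z hz
        rw [show h z = _ from hz]
        simp [h, hne]
  have : h = 1 := LocallyConstant.ext fun y => h1 y trivial
  rw [this, map_one] at h0
  exact one_ne_zero h0

/-- A criterion for a `K`-algebra to be the algebra of locally constant functions on a compact
space. -/
theorem bijective_of_points {T : Set R} (hT : Algebra.adjoin K T = ⊤)
    (hs : ∀ t ∈ T, IsSplitElt K t) (E : R →ₐ[K] LocallyConstant X K)
    (hpt : ∀ f : R →ₐ[K] K, ∃ x, ∀ r, f r = E r x)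
    (hsep : ∀ x y : X, x ≠ y → ∃ r, E r x ≠ E r y) : Function.Bijective E := by
  refine ⟨(injective_iff_map_eq_zero E).2 fun z hz => ?_, ?_⟩
  · refine eq_zero_of_forall_point hT hs fun f => ?_
    obtain ⟨x, hx⟩ := hpt f
    rw [hx, hz, LocallyConstant.zero_apply]
  · rw [← AlgHom.range_eq_top]
    refine subalgebra_eq_top_of_separates _ fun x y hxy => ?_
    obtain ⟨r, hr⟩ := hsep x y hxy
    exact ⟨E r, ⟨r, rfl⟩, hr⟩

end Split

end

section

/-! ### Galois descent for locally constant functions -/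

section Descent

variable {k K : Type*} [Field k] [Field K] [Algebra k K]

instance {X : Type*} [TopologicalSpace X] : IsScalarTower k K (LocallyConstant X K) :=
  ⟨fun a b φ => LocallyConstant.ext fun x => by simp⟩

/-- The `K`-linear extension of an algebra homomorphism to locally constant functions. -/
noncomputable def lcExtend {X A : Type*} [TopologicalSpace X] [CommRing A] [Algebra k A]
    (ev : A →ₐ[k] LocallyConstant X K) : K ⊗[k] A →ₐ[K] LocallyConstant X K :=
  Algebra.TensorProduct.lift (Algebra.ofId K _) ev fun _ _ => Commute.all _ _

@[simp]
theorem lcExtend_tmul {X A : Type*} [TopologicalSpace X] [CommRing A] [Algebra k A]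
    (ev : A →ₐ[k] LocallyConstant X K) (c : K) (a : A) (x : X) :
    lcExtend ev (c ⊗ₜ[k] a) x = c * ev a x := by
  simp [lcExtend, Algebra.ofId_apply]

/-- The `k`-algebra of locally constant equivariant functions. -/
def eqv (k K X : Type*) [Field k] [Field K] [Algebra k K] [TopologicalSpace X]
    [MulAction Gal(K/k) X] : Subalgebra k (LocallyConstant X K) where
  carrier := {φ | ∀ (g : Gal(K/k)) x, φ (g • x) = g (φ x)}
  mul_mem' ha hb g x := by simp [ha g x, hb g x]
  add_mem' ha hb g x := by simp [ha g x, hb g x]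
  algebraMap_mem' c g x := by simp

variable {X : Type*} [TopologicalSpace X] [MulAction Gal(K/k) X]

/-- Artin's argument: in a shortest `K`-relation between members of a `k`-basis, normalised to have
a coefficient 1, subtracting a Galois conjugate gives a shorter relation. So all coefficients are
fixed by the Galois group and lie in `k`, against independence over `k`. -/
theorem lcExtend_eqv_injective [IsGalois k K] :
    Function.Injective (lcExtend (eqv k K X).val) := by
  classical
  rw [injective_iff_map_eq_zero]
  intro z hz
  let b := Module.Basis.ofVectorSpace k (eqv k K X)
  have key : ∀ (s : Finset (Module.Basis.ofVectorSpaceIndex k (eqv k K X)))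
      (c : Module.Basis.ofVectorSpaceIndex k (eqv k K X) → K),
      (∀ x, ∑ i ∈ s, c i * (b i).1 x = 0) → ∀ i ∈ s, c i = 0 := by
    intro s
    induction s using Finset.induction_on with
    | empty => simp
    | insert j s hj ih =>
      intro c hc
      by_cases hcj : c j = 0
      · intro i hi
        rcases Finset.mem_insert.1 hi with rfl | hi
        · exact hcj
        · refine ih c (fun x => ?_) i hi
          have := hc x
          rwa [Finset.sum_insert hj, hcj, zero_mul, zero_add] at this
      exfalso
      let d := fun i => (c j)⁻¹ * c i
      have hdj : d j = 1 := inv_mul_cancel₀ hcj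
      have hd : ∀ x, ∑ i ∈ insert j s, d i * (b i).1 x = 0 := fun x => by
        rw [← mul_zero (c j)⁻¹, ← hc x, Finset.mul_sum]
        exact Finset.sum_congr rfl fun i _ => mul_assoc _ _ _
      -- Applying `g` to the relation at `g⁻¹ • x` gives a relation at `x` with coefficients `g (d
      -- i)`; the coefficients 1 at `j` cancel in the difference.
      have hfix : ∀ i ∈ s, ∀ g : Gal(K/k), g (d i) = d i := by
        intro i hi g
        refine sub_eq_zero.1 (ih (fun i => g (d i) - d i) (fun x => ?_) i hi)
        have h1 := hd x
        have h2 := congrArg g (hd (g⁻¹ • x))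
        rw [map_zero, map_sum] at h2
        have h3 : ∑ i ∈ insert j s, g (d i) * (b i).1 x = 0 := by
          rw [← h2]
          refine Finset.sum_congr rfl fun i _ => ?_
          rw [(b i).2 g⁻¹ x]
          exact (congrArg (g (d i) * ·) (g.apply_symm_apply _).symm).trans (map_mul g _ _).symm
        rw [Finset.sum_insert hj, hdj] at h1 h3
        rw [map_one] at h3
        simp only [sub_mul, Finset.sum_sub_distrib]
        linear_combination h3 - h1
      have hfix' : ∀ i ∈ insert j s, ∃ y : k, algebraMap k K y = d i := by
        intro i hi
        rcases Finset.mem_insert.1 hi with rfl | hi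
        · exact ⟨1, by rw [hdj, map_one]⟩
        · exact (InfiniteGalois.mem_range_algebraMap_iff_fixed _).2 (hfix i hi)
      choose! y hy using hfix'
      have hsum : ∑ i ∈ insert j s, y i • b i = 0 := Subtype.ext <| LocallyConstant.ext fun x => by
        rw [AddSubmonoidClass.coe_finsetSum]
        change LocallyConstant.evalₐ K x _ = 0
        rw [map_sum, ← hd x]
        refine Finset.sum_congr rfl fun i hi => ?_
        change (y i • (b i).1) x = _
        rw [LocallyConstant.smul_apply, Algebra.smul_def, hy i hi]
      have h0 := linearIndependent_iff'.1 b.linearIndependent _ _ hsum j (Finset.mem_insert_self _ _)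
      have := hy j (Finset.mem_insert_self _ _)
      rw [h0, map_zero, hdj] at this
      exact zero_ne_one this
  let B := Algebra.TensorProduct.basis K b
  have hrepr := B.linearCombination_repr z
  rw [← hrepr, Finsupp.linearCombination_apply, Finsupp.sum] at hz
  have h0 := key (B.repr z).support (B.repr z) fun x => by
    have := congrArg (LocallyConstant.evalₐ K x) hz
    rw [map_sum, map_sum, map_zero] at this
    rw [← this]
    refine Finset.sum_congr rfl fun i _ => ?_
    rw [map_smul, map_smul, smul_eq_mul, Algebra.TensorProduct.basis_apply]
    congr 1
    exact (by simp : (b i).1 x = lcExtend (eqv k K X).val (1 ⊗ₜ[k] b i) x)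
  rw [← B.repr.map_eq_zero_iff]
  ext i
  by_cases hi : i ∈ (B.repr z).support
  · exact h0 i hi
  · simpa using hi

variable [CompactSpace X] [T2Space X] [TotallyDisconnectedSpace X] [ContinuousSMul Gal(K/k) X]

open scoped Pointwise in
/-- Equivariant locally constant functions separate points. -/
theorem eqv_separates [IsGalois k K] {x y : X} (hxy : x ≠ y) :
    ∃ φ ∈ eqv k K X, φ x ≠ φ y := by
  classical
  obtain ⟨C, hC, hxC, hyC⟩ : ∃ C : Set X, IsClopen C ∧ x ∈ C ∧ y ∈ Cᶜ :=
    exists_isClopen_of_totally_separated hxy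
  have hU : {g : Gal(K/k) | g⁻¹ • y ∉ C} ∈ nhds 1 := by
    have hc : Continuous fun g : Gal(K/k) => g⁻¹ • y := by fun_prop
    refine (hC.compl.isOpen.preimage hc).mem_nhds ?_
    change (1 : Gal(K/k))⁻¹ • y ∉ C
    simpa using hyC
  obtain ⟨L, hL, hLU⟩ := (krullTopology_mem_nhds_one_iff k K _).1 hU
  let res : Gal(K/k) → (L →ₐ[k] K) := fun g => (g : K →ₐ[k] K).comp L.val
  -- The restrictions to `L` of those `g` for which the point lies in `g • C`. This finite invariant
  -- is equivariant and, by the choice of `L`, distinguishes `x` from `y`.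
  let T : X → Set (L →ₐ[k] K) := fun x => {ι | ∃ g : Gal(K/k), res g = ι ∧ g⁻¹ • x ∈ C}
  have hfib : ∀ ι, IsClosed {g | res g = ι} ∧ IsOpen {g | res g = ι} := by
    intro ι
    by_cases hne : ∃ g₀, res g₀ = ι
    · obtain ⟨g₀, rfl⟩ := hne
      have : {g | res g = res g₀} = (fun g => g₀⁻¹ * g) ⁻¹' (L.fixingSubgroup : Set Gal(K/k)) := by
        ext g
        rw [Set.mem_preimage, SetLike.mem_coe, IntermediateField.mem_fixingSubgroup_iff]
        change res g = res g₀ ↔ _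
        rw [AlgHom.ext_iff]
        constructor
        · intro h z hz
          have h1 : g z = g₀ z := h ⟨z, hz⟩
          change g₀.symm (g z) = z
          rw [h1, AlgEquiv.symm_apply_apply]
        · intro h z
          have h1 : g₀.symm (g z) = z := h z z.2
          change g z = g₀ z
          rw [← AlgEquiv.symm_apply_eq]
          exact h1
      rw [this]
      exact ⟨(InfiniteGalois.fixingSubgroup_isClosed L).preimage (continuous_const_mul _),
        (IntermediateField.fixingSubgroup_isOpen L).preimage (continuous_const_mul _)⟩
    · have : {g | res g = ι} = ∅ := Set.eq_empty_of_forall_notMem fun g hg => hne ⟨g, hg⟩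
      simp [this]
  have hT : ∀ ι, IsClopen {z | ι ∈ T z} := by
    intro ι
    -- A union of translates of the open set `C`, and the product of a compact set of group elements
    -- with the compact set `C`: hence clopen.
    have : {z | ι ∈ T z} = {g | res g = ι} • C := by
      ext z
      constructor
      · rintro ⟨g, hg, hgz⟩
        exact ⟨g, hg, _, hgz, smul_inv_smul g z⟩
      · rintro ⟨g, hg, w, hw, rfl⟩
        exact ⟨g, hg, by simpa using hw⟩
    rw [this]
    refine ⟨?_, hC.isOpen.smul_left⟩
    exact ((hfib ι).1.isCompact.smul_set hC.isClosed.isCompact).isClosed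
  have : Fintype (L →ₐ[k] K) := Fintype.ofFinite _
  -- A partial trace: the sum of `ι c` over `ι ∈ T z`, equivariant in `z` because `T` is.
  let Φ : L → LocallyConstant X K := fun c => ∑ ι, ι c • LocallyConstant.charFn K (hT ι)
  have hΦ : ∀ c z, Φ c z = ∑ ι, if ι ∈ T z then ι c else 0 := by
    intro c z
    change LocallyConstant.evalₐ K z _ = _
    rw [map_sum]
    refine Finset.sum_congr rfl fun ι _ => ?_
    change ι c * LocallyConstant.charFn K (hT ι) z = _
    rw [LocallyConstant.coe_charFn, Set.indicator_apply]
    simp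
  by_contra! hcon
  have heq : ∀ c, Φ c x = Φ c y := by
    refine fun c => hcon (Φ c) fun g z => ?_
    rw [hΦ, hΦ, map_sum]
    let e : (L →ₐ[k] K) ≃ (L →ₐ[k] K) :=
      { toFun := fun ι => (g : K →ₐ[k] K).comp ι
        invFun := fun ι => (g.symm : K →ₐ[k] K).comp ι
        left_inv := fun ι => by ext; simp
        right_inv := fun ι => by ext; simp }
    refine (Equiv.sum_comp e _).symm.trans (Finset.sum_congr rfl fun ι _ => ?_)
    have : e ι ∈ T (g • z) ↔ ι ∈ T z := by
      constructor
      · rintro ⟨h, hh, hz⟩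
        refine ⟨g⁻¹ * h, ?_, by simpa [mul_smul] using hz⟩
        ext w
        have h1 : h w = g (ι w) := AlgHom.congr_fun hh w
        change g.symm (h w) = ι w
        rw [h1, AlgEquiv.symm_apply_apply]
      · rintro ⟨h, rfl, hz⟩
        exact ⟨g * h, rfl, by simpa [mul_smul] using hz⟩
    rw [apply_ite g, map_zero]
    exact if_congr this rfl rfl
  -- By Dedekind independence of the embeddings, the values `Φ c z` for all `c` determine `T z`.
  have hlin := linearIndependent_toLinearMap k L K
  have h0 := Fintype.linearIndependent_iff.1 hlin
    (fun ι => (if ι ∈ T x then 1 else 0) - if ι ∈ T y then 1 else 0) (LinearMap.ext fun c => by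
      have := heq c
      rw [hΦ, hΦ, ← sub_eq_zero, ← Finset.sum_sub_distrib] at this
      rw [LinearMap.zero_apply, LinearMap.sum_apply]
      refine Eq.trans (Finset.sum_congr rfl fun ι _ => ?_) this
      rw [LinearMap.smul_apply, smul_eq_mul, sub_mul]
      simp) L.val
  have hx : L.val ∈ T x := ⟨1, rfl, by simpa using hxC⟩
  have hy : L.val ∉ T y := by
    rintro ⟨g, hg, hgy⟩
    refine hLU ?_ hgy
    refine (IntermediateField.mem_fixingSubgroup_iff _ _).2 fun z hz => ?_
    exact AlgHom.congr_fun hg ⟨z, hz⟩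
  simp [hx, hy] at h0

/-- The range contains the equivariant functions, which already separate points. -/
theorem lcExtend_eqv_bijective [IsGalois k K] :
    Function.Bijective (lcExtend (eqv k K X).val) := by
  refine ⟨lcExtend_eqv_injective, ?_⟩
  rw [← AlgHom.range_eq_top]
  refine subalgebra_eq_top_of_separates _ fun x y hxy => ?_
  obtain ⟨φ, hφ, hne⟩ := eqv_separates (k := k) (K := K) hxy
  exact ⟨φ, ⟨1 ⊗ₜ ⟨φ, hφ⟩, LocallyConstant.ext fun z => by simp⟩, hne⟩

/-- Extended `K`-linearly, a `k`-point becomes a `K`-point of the algebra of all locally constant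
functions, hence an evaluation. -/
theorem exists_eq_eval_eqv [IsGalois k K] (f : eqv k K X →ₐ[k] K) : ∃ x, ∀ φ, f φ = φ.1 x := by
  let e := AlgEquiv.ofBijective _ (lcExtend_eqv_bijective (k := k) (K := K) (X := X))
  let F : K ⊗[k] eqv k K X →ₐ[K] K :=
    Algebra.TensorProduct.lift (AlgHom.id K K) f fun _ _ => Commute.all _ _
  obtain ⟨x, hx⟩ := exists_eq_eval (F.comp e.symm.toAlgHom)
  refine ⟨x, fun φ => ?_⟩
  have := hx (e (1 ⊗ₜ φ))
  simpa [F, e] using this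

/-- After base change to `K` the algebra is a finite power of `K`; étaleness descends along the
faithfully flat `k → K`. -/
theorem etale_eqv [IsSepClosure k K] [Finite X] : Algebra.Etale k (eqv k K X) := by
  have : IsGalois k K := inferInstance
  have : DiscreteTopology X := inferInstance
  let e := AlgEquiv.ofBijective _ (lcExtend_eqv_bijective (k := k) (K := K) (X := X))
  let e' : (X → K) ≃ₐ[K] LocallyConstant X K :=
    (AlgEquiv.ofBijective (LocallyConstant.coeFnAlgHom K) ⟨LocallyConstant.coe_injective,
      fun f => ⟨⟨f, IsLocallyConstant.of_discrete f⟩, rfl⟩⟩).symm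
  have : Algebra.Etale K (K ⊗[k] eqv k K X) := Algebra.Etale.of_equiv (e'.trans e.symm)
  exact Algebra.Etale.of_etale_tensorProduct_of_faithfullyFlat K

end Descent

end

section

/-! ### Functoriality of equivariant functions -/

section Pullback

variable {k K : Type*} [Field k] [Field K] [Algebra k K] {X Y : Type*} [TopologicalSpace X]
  [TopologicalSpace Y] [MulAction Gal(K/k) X] [MulAction Gal(K/k) Y]

/-- Pullback of equivariant functions along an equivariant map. -/
def eqvPullback (t : X → Y) (ht : Continuous t) (hg : ∀ (g : Gal(K/k)) x, t (g • x) = g • t x) :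
    eqv k K Y →ₐ[k] eqv k K X :=
  ((LocallyConstant.comapₐ k ⟨t, ht⟩).comp (eqv k K Y).val).codRestrict (eqv k K X)
    fun φ g x => by
      change φ.1 (t (g • x)) = g (φ.1 (t x))
      rw [hg, φ.2]

end Pullback

variable {k K : Type u} [Field k] [Field K] [Algebra k K] {σ : k →+* k} {τ : K →+* K}

section TwistedPullback

variable {X Y : Type*} [TopologicalSpace X] [TopologicalSpace Y] [MulAction Gal(K/k) X]
  [MulAction Gal(K/k) Y] [IsSepClosure k K]
  (hτ : ∀ c : k, τ (algebraMap k K c) = algebraMap k K (σ c))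

/-- Pullback `φ ↦ τ ∘ φ ∘ t` of equivariant functions along a map that is equivariant up to the
endomorphism of the Galois group. -/
noncomputable def eqvTwistedPullback (t : X → Y) (ht : Continuous t)
    (hg : ∀ (g : Gal(K/k)) x, t (g • x) = galTwist hτ g • t x) :
    eqv k K Y →+* eqv k K X where
  toFun φ := ⟨(φ.1.comap ⟨t, ht⟩).map τ, fun g x => by
    change τ (φ.1 (t (g • x))) = g (τ (φ.1 (t x)))
    rw [hg, φ.2, galTwist_spec]⟩
  map_one' := Subtype.ext <| LocallyConstant.ext fun x => map_one τ
  map_mul' φ ψ := Subtype.ext <| LocallyConstant.ext fun x => map_mul τ _ _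
  map_zero' := Subtype.ext <| LocallyConstant.ext fun x => map_zero τ
  map_add' φ ψ := Subtype.ext <| LocallyConstant.ext fun x => map_add τ _ _

theorem eqvTwistedPullback_algebraMap (t : X → Y) (ht : Continuous t)
    (hg : ∀ (g : Gal(K/k)) x, t (g • x) = galTwist hτ g • t x) (c : k) :
    eqvTwistedPullback hτ t ht hg (algebraMap k _ c) = algebraMap k _ (σ c) :=
  Subtype.ext <| LocallyConstant.ext fun _ => hτ c

end TwistedPullback

/-! ### Points of algebras generated by split elements -/

section Points

theorem continuous_eval (A : DiffAlg σ) (a : A) :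
    letI : TopologicalSpace K := ⊥
    Continuous fun f : Pts K A => f.hom a := by
  let : TopologicalSpace K := ⊥
  exact (continuous_apply a).comp (isClosedEmbedding_eval (K := K) A).continuous

/-- Elements of `A` as locally constant functions on the space of points. -/
def ptsEval (K : Type u) [Field K] [Algebra k K] (A : DiffAlg σ) :
    A →ₐ[k] LocallyConstant (Pts K A) K where
  toFun a := ⟨fun f => f.hom a, by
    let : TopologicalSpace K := ⊥
    have : DiscreteTopology K := ⟨rfl⟩
    exact (IsLocallyConstant.iff_continuous _).2 (continuous_eval A a)⟩
  map_one' := LocallyConstant.ext fun f => map_one f.hom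
  map_mul' a b := LocallyConstant.ext fun f => map_mul f.hom a b
  map_zero' := LocallyConstant.ext fun f => map_zero f.hom
  map_add' a b := LocallyConstant.ext fun f => map_add f.hom a b
  commutes' c := LocallyConstant.ext fun f => f.hom.commutes c

@[simp]
theorem ptsEval_apply (A : DiffAlg σ) (a : A) (f : Pts K A) : ptsEval K A a f = f.hom a := rfl

theorem adjoin_image_tmul {A : Type*} [CommRing A] [Algebra k A] {S : Set A}
    (hS : Algebra.adjoin k S = ⊤) :
    Algebra.adjoin K ((fun a => (1 : K) ⊗ₜ[k] a) '' S) = ⊤ := by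
  have hle : Algebra.adjoin k S ≤
      ((Algebra.adjoin K ((fun a => (1 : K) ⊗ₜ[k] a) '' S)).restrictScalars k).comap
        (Algebra.TensorProduct.includeRight : A →ₐ[k] K ⊗[k] A) :=
    Algebra.adjoin_le fun a ha => Algebra.subset_adjoin (Set.mem_image_of_mem _ ha)
  rw [hS] at hle
  refine eq_top_iff.2 fun z _ => ?_
  induction z with
  | zero => exact zero_mem _
  | add x y hx hy => exact add_mem (hx trivial) (hy trivial)
  | tmul c a =>
    have h : (1 : K) ⊗ₜ[k] a ∈ Algebra.adjoin K ((fun a => (1 : K) ⊗ₜ[k] a) '' S) :=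
      hle (Algebra.mem_top (x := a))
    have := Subalgebra.smul_mem _ h c
    rwa [TensorProduct.smul_tmul', smul_eq_mul, mul_one] at this

/-- The `K`-points of `K ⊗ A` are the `k`-points of `A`, so `bijective_of_points` applies with the
split generators. -/
theorem lcExtend_ptsEval_bijective (A : DiffAlg σ) [CompactSpace (Pts K A)] {S : Set A}
    (hS : Algebra.adjoin k S = ⊤) (hs : ∀ a ∈ S, IsSplitElt K ((1 : K) ⊗ₜ[k] a)) :
    Function.Bijective (lcExtend (ptsEval K A)) := by
  refine bijective_of_points (adjoin_image_tmul hS) (by simpa using hs) _ (fun F => ?_)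
    fun f g hfg => ?_
  · let f : A →ₐ[k] K := (F.restrictScalars k).comp Algebra.TensorProduct.includeRight
    let f' : Pts K A := f
    refine ⟨f', fun r => ?_⟩
    induction r with
    | zero => rw [map_zero, map_zero]; rfl
    | add x y hx hy => rw [map_add, hx, hy, map_add]; rfl
    | tmul c a =>
      refine Eq.trans ?_ (lcExtend_tmul (ptsEval K A) c a f').symm
      change F (c ⊗ₜ a) = c * F (1 ⊗ₜ a)
      rw [← smul_eq_mul, ← map_smul, TensorProduct.smul_tmul', smul_eq_mul, mul_one]
  · by_contra! h
    refine hfg (AlgHom.ext fun a => ?_)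
    simpa using h (1 ⊗ₜ a)

theorem isSplitElt_of_isLocEtale {A : DiffAlg σ} (hA : IsLocEtale τ A) (a : A) :
    IsSplitElt K ((1 : K) ⊗ₜ[k] a) := by
  obtain ⟨X, _, _, _, _, t, _, e, he⟩ := hA
  exact .of_injective e.toAlgHom e.injective
    (isSplitElt_of_finite_range _ (LocallyConstant.range_finite _))

theorem lcExtend_ptsEval_bijective_of_isLocEtale {A : DiffAlg σ} (hA : IsLocEtale τ A) :
    Function.Bijective (lcExtend (ptsEval K A)) :=
  have := compactSpace_pts hA
  lcExtend_ptsEval_bijective A (S := Set.univ) (Algebra.adjoin_univ _ _)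
    fun a _ => isSplitElt_of_isLocEtale hA a

/-- The image of a split element under a pair of compatible ring homomorphisms. -/
theorem IsSplitElt.map {A R : Type*} [CommRing A] [Algebra k A] [CommRing R] {a : A}
    (ha : IsSplitElt K ((1 : K) ⊗ₜ[k] a)) (f : K →+* R) (g : A →+* R)
    (h : ∀ c : k, f (algebraMap k K c) = g (algebraMap k A c)) :
    ∃ s : Finset K, ∏ y ∈ s, (g a - f y) = 0 := by
  obtain ⟨s, hs⟩ := ha
  obtain ⟨F, hF⟩ := exists_tensor_lift f g h
  refine ⟨s, ?_⟩
  rw [← map_zero F, ← hs, map_prod]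
  refine Finset.prod_congr rfl fun y _ => ?_
  rw [map_sub, Algebra.TensorProduct.algebraMap_apply, hF, hF]
  simp

/-- A vanishing product of differences `g a - f y` in a field has a vanishing factor. With `f = τ`
this puts values of `σ`-linear maps into the range of `τ`. -/
theorem IsSplitElt.exists_eq {A : Type*} [CommRing A] [Algebra k A] {a : A}
    (ha : IsSplitElt K ((1 : K) ⊗ₜ[k] a)) (f : K →+* K) (g : A →+* K)
    (h : ∀ c : k, f (algebraMap k K c) = g (algebraMap k A c)) : ∃ y, f y = g a := by
  obtain ⟨s, hs⟩ := ha.map f g h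
  obtain ⟨y, -, hy⟩ := Finset.prod_eq_zero_iff.1 hs
  exact ⟨y, (sub_eq_zero.1 hy).symm⟩

theorem IsSplitElt.finite_values {A : Type*} [CommRing A] [Algebra k A] {a : A}
    (ha : IsSplitElt K ((1 : K) ⊗ₜ[k] a)) : {y : K | ∃ f : A →ₐ[k] K, f a = y}.Finite := by
  obtain ⟨s, hs⟩ := ha
  refine s.finite_toSet.subset ?_
  rintro _ ⟨f, rfl⟩
  let F : K ⊗[k] A →ₐ[K] K :=
    Algebra.TensorProduct.lift (AlgHom.id K K) f fun _ _ => Commute.all _ _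
  have := congrArg F hs
  rw [map_prod, map_zero, Finset.prod_eq_zero_iff] at this
  obtain ⟨y, hy, h⟩ := this
  rw [map_sub, AlgHom.commutes, sub_eq_zero] at h
  have h' : F (1 ⊗ₜ a) = f a := by simp [F]
  rw [← h', h]
  exact hy

/-- An algebra generated by split elements is difference locally étale. -/
theorem isLocEtale_of_adjoin_eq_top
    (hτ : ∀ c : k, τ (algebraMap k K c) = algebraMap k K (σ c)) (A : DiffAlg σ) {S : Set A}
    (hS : Algebra.adjoin k S = ⊤) (hs : ∀ a ∈ S, IsSplitElt K ((1 : K) ⊗ₜ[k] a)) :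
    IsLocEtale τ A := by
  let : TopologicalSpace K := ⊥
  have : DiscreteTopology K := ⟨rfl⟩
  -- Compactness of the space of points needs finitely many values at every element; this passes
  -- from generators to sums and products.
  have hfin : ∀ a : A, {y : K | ∃ f : A →ₐ[k] K, f a = y}.Finite := by
    intro a
    induction (hS ▸ Algebra.mem_top : a ∈ Algebra.adjoin k S) using Algebra.adjoin_induction with
    | mem a ha => exact (hs a ha).finite_values
    | algebraMap c =>
      refine (Set.finite_singleton (algebraMap k K c)).subset ?_
      rintro _ ⟨f, rfl⟩
      exact f.commutes c
    | add a b _ _ ha hb =>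
      refine (Set.Finite.image2 (· + ·) ha hb).subset ?_
      rintro _ ⟨f, rfl⟩
      exact ⟨_, ⟨f, rfl⟩, _, ⟨f, rfl⟩, (map_add f a b).symm⟩
    | mul a b _ _ ha hb =>
      refine (Set.Finite.image2 (· * ·) ha hb).subset ?_
      rintro _ ⟨f, rfl⟩
      exact ⟨_, ⟨f, rfl⟩, _, ⟨f, rfl⟩, (map_mul f a b).symm⟩
  have hemb := isClosedEmbedding_eval (K := K) A
  have : CompactSpace (Pts K A) := by
    have hc : IsCompact (Set.univ.pi fun a : A => {y : K | ∃ f : A →ₐ[k] K, f a = y}) :=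
      isCompact_univ_pi fun a => (hfin a).isCompact
    exact ⟨(hemb.isCompact_preimage hc).of_isClosed_subset isClosed_univ fun f _ =>
      Set.mem_preimage.2 (Set.mem_univ_pi.2 fun a => Exists.intro f.hom rfl)⟩
  -- The elements whose shift is sent by `f` into the range of `τ` form a subalgebra, so generators
  -- suffice.
  have hlift : ∀ (f : A →ₐ[k] K) (a : A), ∃ y, τ y = f (A.shift a) := by
    intro f a
    let R : Subalgebra k A :=
      { (τ.range).comap ((f : A →+* K).comp A.shift) with
        algebraMap_mem' := fun c => ⟨algebraMap k K c, by
          simp [hτ, A.shift_algebraMap]⟩ }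
    have hle : Algebra.adjoin k S ≤ R := Algebra.adjoin_le fun a ha =>
      (hs a ha).exists_eq τ ((f : A →+* K).comp A.shift) fun c => by
        simp [hτ, A.shift_algebraMap]
    exact hle (hS ▸ Algebra.mem_top)
  let t : Pts K A → Pts K A := fun f => twist hτ A f (hlift f)
  have ht : ∀ (f : Pts K A) a, τ ((t f).hom a) = f.hom (A.shift a) :=
    fun f a => twist_spec hτ A f (hlift f) a
  have htc : Continuous t := by
    refine hemb.isInducing.continuous_iff.2 (continuous_pi fun a => ?_)
    have h2 : (fun f : Pts K A => (t f).hom a) =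
        Function.invFun τ ∘ fun f : Pts K A => f.hom (A.shift a) := by
      funext f
      rw [Function.comp_apply, ← ht f a]
      exact (Function.leftInverse_invFun τ.injective _).symm
    change Continuous fun f : Pts K A => (t f).hom a
    rw [h2]
    exact continuous_of_discreteTopology.comp (continuous_eval A _)
  refine ⟨Pts K A, inferInstance, inferInstance, t2Space_pts A, totallyDisconnectedSpace_pts A, t,
    htc, AlgEquiv.ofBijective _ (lcExtend_ptsEval_bijective A hS hs), fun c a f => ?_⟩
  simp only [AlgEquiv.coe_ofBijective, lcExtend_tmul, ptsEval_apply, map_mul]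
  rw [ht]

/-- The split elements of `A` are mapped to split elements by its shift. -/
theorem IsSplitElt.shift (hτ : ∀ c : k, τ (algebraMap k K c) = algebraMap k K (σ c))
    (A : DiffAlg σ) {a : A} (ha : IsSplitElt K ((1 : K) ⊗ₜ[k] a)) :
    IsSplitElt K ((1 : K) ⊗ₜ[k] A.shift a) := by
  classical
  obtain ⟨s, hs⟩ := ha.map ((algebraMap K (K ⊗[k] A)).comp τ)
    ((Algebra.TensorProduct.includeRight : A →ₐ[k] K ⊗[k] A).toRingHom.comp A.shift) fun c => by
      simp [hτ, A.shift_algebraMap]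
  refine ⟨s.image τ, ?_⟩
  rw [Finset.prod_image τ.injective.injOn]
  exact hs

theorem IsSplitElt.shift_iterate (hτ : ∀ c : k, τ (algebraMap k K c) = algebraMap k K (σ c))
    (A : DiffAlg σ) {a : A} (ha : IsSplitElt K ((1 : K) ⊗ₜ[k] a)) (i : ℕ) :
    IsSplitElt K ((1 : K) ⊗ₜ[k] A.shift^[i] a) := by
  induction i with
  | zero => exact ha
  | succ i ih =>
    rw [Function.iterate_succ_apply']
    exact ih.shift hτ A

/-- Over the separably closed `K`, the étale algebra `K ⊗ A` is a finite power of `K`; the roots are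
the coordinates of the element. -/
theorem isSplitElt_of_etale [IsSepClosure k K] {A : Type u} [CommRing A] [Algebra k A]
    [Algebra.Etale k A] (a : A) : IsSplitElt K ((1 : K) ⊗ₜ[k] a) := by
  have : IsSepClosed K := IsSepClosure.sep_closed k
  obtain ⟨n, ⟨e⟩⟩ := Algebra.IsFiniteSplit.nonempty_algEquiv_fun K (K ⊗[k] A)
  refine .of_injective e.toAlgHom e.injective ?_
  classical
  refine ⟨Finset.univ.image (e (1 ⊗ₜ a)), funext fun i => ?_⟩
  rw [Finset.prod_apply]
  exact Finset.prod_eq_zero (Finset.mem_image_of_mem _ (Finset.mem_univ i)) (by simp)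

theorem eq_of_forall_pts {A : DiffAlg σ} (hA : IsLocEtale τ A) {a b : A}
    (h : ∀ f : A →ₐ[k] K, f a = f b) : a = b := by
  have h1 : (1 : K) ⊗ₜ[k] a = 1 ⊗ₜ b :=
    (lcExtend_ptsEval_bijective_of_isLocEtale hA).1 (LocallyConstant.ext fun f => by
      simpa using h f.hom)
  exact Algebra.TensorProduct.includeRight_injective (algebraMap k K).injective h1

end Points

/-! ### Equivariant functions as a difference locally étale algebra -/

section Functions

variable [IsSepClosure k K] (hτ : ∀ c : k, τ (algebraMap k K c) = algebraMap k K (σ c))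

/-- The difference algebra of equivariant locally constant functions on `X`. -/
noncomputable def fnAlg (X : DiffGProf (galShift (K := K) hτ)) : DiffAlg σ where
  carrier := eqv k K X
  shift := eqvTwistedPullback hτ X.shift X.continuous_shift X.shift_smul
  shift_algebraMap := eqvTwistedPullback_algebraMap hτ _ _ _

theorem isLocEtale_fnAlg (X : DiffGProf (galShift (K := K) hτ)) : IsLocEtale τ (fnAlg hτ X) := by
  have : IsGalois k K := inferInstance
  refine ⟨X, inferInstance, inferInstance, inferInstance, inferInstance, X.shift,
    X.continuous_shift,
    AlgEquiv.ofBijective _ (lcExtend_eqv_bijective (k := k) (K := K) (X := X)), fun c a x => ?_⟩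
  refine (lcExtend_tmul (eqv k K X).val (τ c) _ x).trans ?_
  refine Eq.trans ?_ (congrArg τ (lcExtend_tmul (eqv k K X).val c a (X.shift x))).symm
  rw [map_mul]
  rfl

/-- A difference locally étale algebra is the algebra of equivariant locally constant functions
on its space of points. -/
theorem exists_eq_eval_pts {A : DiffAlg σ} (hA : IsLocEtale τ A) (φ : eqv k K (Pts K A)) :
    ∃ a : A, ∀ f : Pts K A, f.hom a = φ.1 f := by
  have : IsGalois k K := inferInstance
  let ev : A →ₐ[k] eqv k K (Pts K A) := (ptsEval K A).codRestrict _ fun a g f => rfl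
  have hcomp : ∀ z, lcExtend (eqv k K (Pts K A)).val (ev.toLinearMap.lTensor K z) =
      lcExtend (ptsEval K A) z := by
    intro z
    induction z with
    | zero => simp
    | add x y hx hy => rw [map_add, map_add, hx, hy, map_add]
    | tmul c a => exact LocallyConstant.ext fun f =>
        (lcExtend_tmul _ c (ev a) f).trans (lcExtend_tmul (ptsEval K A) c a f).symm
  -- Composing the base change of `ev` with an injection gives a surjection, so the base change is
  -- surjective; faithful flatness then descends this to `ev`.
  have hsurj : Function.Surjective (ev.toLinearMap.lTensor K) := by
    intro z
    obtain ⟨w, hw⟩ := (lcExtend_ptsEval_bijective_of_isLocEtale hA).2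
      (lcExtend (eqv k K (Pts K A)).val z)
    exact ⟨w, lcExtend_eqv_injective ((hcomp w).trans hw)⟩
  obtain ⟨a, ha⟩ := (Module.FaithfullyFlat.lTensor_surjective_iff_surjective k K _).1 hsurj φ
  exact ⟨a, fun f => congrArg (fun ψ : eqv k K (Pts K A) => ψ.1 f) ha⟩

end Functions

end

section

/-! ### Monomorphisms and equalisers of difference profinite sets -/

section Prof

variable {G : Type u} [Group G] [TopologicalSpace G] {φ : G →ₜ* G}

namespace DiffGProf

theorem comp_toFun {X Y Z : DiffGProf φ} (f : X ⟶ Y) (g : Y ⟶ Z) (x : X) :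
    (f ≫ g).toFun x = g.toFun (f.toFun x) := rfl

theorem hom_ext {X Y : DiffGProf φ} {f g : X ⟶ Y} (h : ∀ x, f.toFun x = g.toFun x) : f = g :=
  Hom.ext (funext h)

theorem toFun_eq_of_eq {X Y : DiffGProf φ} {f g : X ⟶ Y} (h : f = g) (x : X) :
    f.toFun x = g.toFun x := by rw [h]

/-- The subobject carried by an invariant closed subset. -/
def sub (Y : DiffGProf φ) (S : Set Y) (hS : IsClosed S) (hG : ∀ (g : G), ∀ y ∈ S, g • y ∈ S)
    (hs : ∀ y ∈ S, Y.shift y ∈ S) : DiffGProf φ :=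
  letI : MulAction G S :=
    { smul := fun g y => ⟨g • y.1, hG g y.1 y.2⟩
      one_smul := fun y => Subtype.ext (one_smul G y.1)
      mul_smul := fun g h y => Subtype.ext (mul_smul g h y.1) }
  { carrier := S
    compact := isCompact_iff_compactSpace.1 hS.isCompact
    continuousSMul := ⟨((continuous_fst.smul
      (continuous_subtype_val.comp continuous_snd)).subtype_mk _ :
        Continuous fun q : G × S => (⟨q.1 • q.2.1, hG q.1 q.2.1 q.2.2⟩ : S))⟩
    shift := fun y => ⟨Y.shift y.1, hs y.1 y.2⟩
    continuous_shift := (Y.continuous_shift.comp continuous_subtype_val).subtype_mk _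
    shift_smul := fun g y => Subtype.ext (Y.shift_smul g y.1) }

/-- The inclusion of `sub`. -/
def subι (Y : DiffGProf φ) (S : Set Y) (hS : IsClosed S) (hG : ∀ (g : G), ∀ y ∈ S, g • y ∈ S)
    (hs : ∀ y ∈ S, Y.shift y ∈ S) : Y.sub S hS hG hs ⟶ Y where
  toFun := Subtype.val
  continuous_toFun := continuous_subtype_val
  map_smul _ _ := rfl
  map_shift _ := rfl

/-- An injective continuous map from a compact to a Hausdorff space is a closed embedding, so a
pointwise factorisation is automatically a morphism. -/
theorem exists_lift {T X Y : DiffGProf φ} (i : T ⟶ Y) (j : X ⟶ Y)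
    (hj : Function.Injective j.toFun) (h : ∀ t, ∃ x, j.toFun x = i.toFun t) :
    ∃ l : T ⟶ X, l ≫ j = i := by
  choose l hl using h
  have hemb : Topology.IsClosedEmbedding j.toFun := j.continuous_toFun.isClosedEmbedding hj
  refine ⟨⟨l, ?_, fun g t => hj ?_, fun t => hj ?_⟩, hom_ext hl⟩
  · rw [hemb.isInducing.continuous_iff]
    exact i.continuous_toFun.congr fun t => (hl t).symm
  · rw [hl, j.map_smul, hl, i.map_smul]
  · rw [hl, j.map_shift, hl, i.map_shift]

theorem mono_of_injective {X Y : DiffGProf φ} (j : X ⟶ Y) (hj : Function.Injective j.toFun) :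
    Mono j :=
  ⟨fun _ _ h => hom_ext fun t => hj (toFun_eq_of_eq h t)⟩

theorem nonempty_iso_of_range_eq {X X' Y : DiffGProf φ} (i : X ⟶ Y) (j : X' ⟶ Y)
    (hi : Function.Injective i.toFun) (hj : Function.Injective j.toFun)
    (h : Set.range i.toFun = Set.range j.toFun) : Nonempty (X ≅ X') := by
  obtain ⟨l, hl⟩ := exists_lift i j hj fun t => (Set.ext_iff.1 h _).1 ⟨t, rfl⟩
  obtain ⟨m, hm⟩ := exists_lift j i hi fun t => (Set.ext_iff.1 h _).2 ⟨t, rfl⟩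
  have := mono_of_injective i hi
  have := mono_of_injective j hj
  exact ⟨⟨l, m, by rw [← cancel_mono i, Category.assoc, hm, hl, Category.id_comp],
    by rw [← cancel_mono j, Category.assoc, hl, hm, Category.id_comp]⟩⟩

theorem isIso_of_bijective {X Y : DiffGProf φ} (f : X ⟶ Y) (hf : Function.Bijective f.toFun) :
    IsIso f := by
  obtain ⟨l, hl⟩ := exists_lift (𝟙 Y) f hf.1 fun t => hf.2 t
  have := mono_of_injective f hf.1
  exact ⟨l, by rw [← cancel_mono f, Category.assoc, hl, Category.comp_id, Category.id_comp], hl⟩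

/-- The product of two difference profinite sets. -/
def prod (X Y : DiffGProf φ) : DiffGProf φ where
  carrier := X × Y
  shift p := (X.shift p.1, Y.shift p.2)
  continuous_shift := (X.continuous_shift.comp continuous_fst).prodMk
    (Y.continuous_shift.comp continuous_snd)
  shift_smul g p := Prod.ext (X.shift_smul g p.1) (Y.shift_smul g p.2)

/-- The kernel pair of `j` is a closed invariant subset of `X × X`, hence an object; `j` equalises
its two projections, so they coincide. -/
theorem injective_of_mono {X Y : DiffGProf φ} (j : X ⟶ Y) [Mono j] :
    Function.Injective j.toFun := by
  intro x y hxy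
  let S : Set (X.prod X) := {p : X × X | j.toFun p.1 = j.toFun p.2}
  have hS : IsClosed S := isClosed_eq (j.continuous_toFun.comp continuous_fst)
    (j.continuous_toFun.comp continuous_snd)
  let P := (X.prod X).sub S hS
    (fun g p (hp : j.toFun p.1 = j.toFun p.2) => show j.toFun (g • p.1) = j.toFun (g • p.2) by
      rw [j.map_smul, j.map_smul, hp])
    (fun p (hp : j.toFun p.1 = j.toFun p.2) =>
      show j.toFun (X.shift p.1) = j.toFun (X.shift p.2) by
        rw [j.map_shift, j.map_shift, hp])
  let f : P ⟶ X := ⟨fun p => p.1.1, continuous_fst.comp continuous_subtype_val,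
    fun _ _ => rfl, fun _ => rfl⟩
  let g : P ⟶ X := ⟨fun p => p.1.2, continuous_snd.comp continuous_subtype_val,
    fun _ _ => rfl, fun _ => rfl⟩
  have hfg : f = g := (cancel_mono j).1 (hom_ext fun p => p.2)
  exact toFun_eq_of_eq hfg (⟨(x, y), hxy⟩ : S)

theorem nonempty_isLimit_fork {X Y Z : DiffGProf φ} {f g : Y ⟶ Z} (i : X ⟶ Y)
    (w : i ≫ f = i ≫ g) (hi : Function.Injective i.toFun)
    (h : ∀ y, f.toFun y = g.toFun y → ∃ x, i.toFun x = y) :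
    Nonempty (Limits.IsLimit (Limits.Fork.ofι i w)) := by
  have := mono_of_injective i hi
  have hl : ∀ s : Limits.Fork f g, ∃ l : s.pt ⟶ X, l ≫ i = s.ι := fun s =>
    exists_lift s.ι i hi fun t => h _ (toFun_eq_of_eq s.condition t)
  choose l hl using hl
  exact ⟨Limits.Fork.IsLimit.mk _ l hl fun s m hm => (cancel_mono i).1 (hm.trans (hl s).symm)⟩

/-- The pointwise equaliser is itself a subobject, so its inclusion factors through the categorical
one. -/
theorem fork_range {X Y Z : DiffGProf φ} {f g : Y ⟶ Z} {i : X ⟶ Y} {w : i ≫ f = i ≫ g}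
    (h : Limits.IsLimit (Limits.Fork.ofι i w)) :
    Set.range i.toFun = {y | f.toFun y = g.toFun y} := by
  refine Set.Subset.antisymm ?_ fun y hy => ?_
  · rintro _ ⟨x, rfl⟩
    exact toFun_eq_of_eq w x
  · have hS : IsClosed {y | f.toFun y = g.toFun y} :=
      isClosed_eq f.continuous_toFun g.continuous_toFun
    have hG : ∀ (a : G), ∀ y ∈ {y | f.toFun y = g.toFun y}, a • y ∈ {y | f.toFun y = g.toFun y} :=
      fun a y (hy : f.toFun y = g.toFun y) => show f.toFun (a • y) = g.toFun (a • y) by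
        rw [f.map_smul, g.map_smul, hy]
    have hs : ∀ y ∈ {y | f.toFun y = g.toFun y}, Y.shift y ∈ {y | f.toFun y = g.toFun y} :=
      fun y (hy : f.toFun y = g.toFun y) => show f.toFun (Y.shift y) = g.toFun (Y.shift y) by
        rw [f.map_shift, g.map_shift, hy]
    have hw : Y.subι _ hS hG hs ≫ f = Y.subι _ hS hG hs ≫ g := hom_ext fun p => p.2
    obtain ⟨l, hl⟩ := Limits.Fork.IsLimit.lift' h (Y.subι _ hS hG hs) hw
    exact ⟨l.toFun ⟨y, hy⟩, toFun_eq_of_eq hl (⟨y, hy⟩ : {y | f.toFun y = g.toFun y})⟩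

theorem IsFinGen.of_iso {X X' : DiffGProf φ} (e : X ≅ X') (h : X.IsFinGen) : X'.IsFinGen := by
  obtain ⟨Y, i, hY, hi⟩ := h
  exact ⟨Y, e.inv ≫ i, hY, inferInstance⟩

theorem IsFinPres.of_iso {X X' : DiffGProf φ} (e : X ≅ X') (h : X.IsFinPres) : X'.IsFinPres := by
  obtain ⟨Y, Z, f, g, i, w, hY, hZ, ⟨hl⟩⟩ := h
  have hinj : Function.Injective (e.inv ≫ i).toFun :=
    have : Mono i := Limits.mono_of_isLimit_fork hl
    injective_of_mono _
  refine ⟨Y, Z, f, g, e.inv ≫ i, by rw [Category.assoc, Category.assoc, w], hY, hZ,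
    nonempty_isLimit_fork _ _ hinj fun y hy => ?_⟩
  obtain ⟨x, rfl⟩ : y ∈ Set.range i.toFun := by rw [fork_range hl]; exact hy
  refine ⟨e.hom.toFun x, ?_⟩
  rw [comp_toFun, ← comp_toFun e.hom, e.hom_inv_id]
  rfl

end DiffGProf

end Prof

theorem restrictsToEquivalence_of_iff {C : Type*} [Category C] {D : Type*} [Category D] (F : C ⥤ D)
    [F.IsEquivalence] (P : ObjectProperty C) (Q : ObjectProperty D)
    (hQ : ∀ {X Y : D}, (X ≅ Y) → Q X → Q Y) (h : ∀ X, P X ↔ Q (F.obj X)) :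
    RestrictsToEquivalence F P Q := by
  refine ⟨fun X => (h X.obj).1 X.property, ?_⟩
  have : (Q.lift (P.ι ⋙ F) fun X => (h X.obj).1 X.property).EssSurj := by
    refine ⟨fun Y => ?_⟩
    have e := F.objObjPreimageIso Y.obj
    exact ⟨⟨F.objPreimage Y.obj, (h _).2 (hQ e.symm Y.property)⟩,
      ⟨Q.fullyFaithfulι.preimageIso e⟩⟩
  exact { }

/-! ### The anti-equivalence -/

section Galois

variable {k K : Type u} [Field k] [Field K] [Algebra k K] [IsSepClosure k K] {σ : k →+* k}
  {τ : K →+* K} (hτ : ∀ c : k, τ (algebraMap k K c) = algebraMap k K (σ c))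

instance : (galFunctor (K := K) hτ).Faithful where
  map_injective {A B} f g h := by
    refine Quiver.Hom.unop_inj (ObjectProperty.hom_ext _ (DiffAlg.Hom.ext (AlgHom.ext fun b => ?_)))
    refine eq_of_forall_pts (K := K) A.unop.property fun p => ?_
    exact AlgHom.congr_fun (DiffGProf.toFun_eq_of_eq h p) b

/-- For each `b`, the function `f ↦ h(f)(b)` on the points of `A` is equivariant, hence evaluation
at an element of `A`. All identities for the resulting map are checked on points. -/
instance : (galFunctor (K := K) hτ).Full where
  map_surjective {A B} h := by
    have hA := A.unop.property
    have hB := B.unop.property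
    let p : Pts K A.unop.obj → Pts K B.unop.obj := h.toFun
    have hex : ∀ b : B.unop.obj, ∃ a : A.unop.obj, ∀ f : Pts K A.unop.obj,
        f.hom a = (p f).hom b := by
      intro b
      obtain ⟨a, ha⟩ := exists_eq_eval_pts hA
        (eqvPullback (k := k) (X := Pts K A.unop.obj) (Y := Pts K B.unop.obj) h.toFun
          h.continuous_toFun h.map_smul ⟨ptsEval K B.unop.obj b, fun g f => rfl⟩)
      exact ⟨a, ha⟩
    choose m hm using hex
    have hm' : ∀ (b : B.unop.obj) (f : A.unop.obj →ₐ[k] K),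
      f (m b) = (p f).hom b := hm
    let m' : B.unop.obj →ₐ[k] A.unop.obj :=
      { toFun := m
        map_one' := eq_of_forall_pts hA fun f => by rw [hm', map_one, map_one]
        map_mul' := fun a b => eq_of_forall_pts hA fun f => by
          rw [map_mul, hm', hm', hm', map_mul]
        map_zero' := eq_of_forall_pts hA fun f => by rw [hm', map_zero, map_zero]
        map_add' := fun a b => eq_of_forall_pts hA fun f => by
          rw [map_add, hm', hm', hm', map_add]
        commutes' := fun c => eq_of_forall_pts hA fun f => by
          rw [hm', AlgHom.commutes, AlgHom.commutes] }
    let H : B.unop.obj ⟶ A.unop.obj := ⟨m', fun b => eq_of_forall_pts hA fun f => by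
      change f (m _) = f (A.unop.obj.shift (m b))
      rw [hm', ← ptsShift_spec hτ hA f (m b), ← ptsShift_spec hτ hB _ b]
      refine congrArg τ ?_
      refine (AlgHom.congr_fun (h.map_shift f) b).symm.trans (hm' b _).symm⟩
    refine ⟨Quiver.Hom.op (ObjectProperty.homMk H), DiffGProf.hom_ext fun f => AlgHom.ext fun b => ?_⟩
    exact hm b f

/-- The unit `X → Hom_k(Cont_G(X, K), K)`. -/
noncomputable def evalHom (X : DiffGProf (galShift (K := K) hτ)) :
    X ⟶ (galFunctor (K := K) hτ).obj (Opposite.op ⟨fnAlg hτ X, isLocEtale_fnAlg hτ X⟩) where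
  toFun x := ((LocallyConstant.evalₐ k x).comp (eqv k K X).val : eqv k K X →ₐ[k] K)
  continuous_toFun := by
    let : TopologicalSpace K := ⊥
    refine (isClosedEmbedding_eval (K := K) (fnAlg hτ X)).isInducing.continuous_iff.2
      (continuous_pi fun φ => ?_)
    exact φ.1.continuous
  map_smul g x := AlgHom.ext fun φ => φ.2 g x
  map_shift x := AlgHom.ext fun φ => τ.injective
    (ptsShift_spec hτ (isLocEtale_fnAlg hτ X)
      ((LocallyConstant.evalₐ k x).comp (eqv k K X).val : eqv k K X →ₐ[k] K) φ).symm

/-- The unit `evalHom` is injective because equivariant functions separate points, and surjective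
because every point of `eqv k K X` is an evaluation. -/
instance : (galFunctor (K := K) hτ).EssSurj where
  mem_essImage X := by
    have : IsGalois k K := inferInstance
    have := DiffGProf.isIso_of_bijective (evalHom hτ X) ⟨fun x y hxy => by
      by_contra hne
      obtain ⟨φ, hφ, h⟩ := eqv_separates (k := k) (K := K) hne
      have hxy' : (LocallyConstant.evalₐ k x).comp (eqv k K X).val =
        (LocallyConstant.evalₐ k y).comp (eqv k K X).val := hxy
      exact h (AlgHom.congr_fun hxy' ⟨φ, hφ⟩), fun f => by
      obtain ⟨x, hx⟩ := exists_eq_eval_eqv (k := k) (K := K) (X := X) f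
      exact ⟨x, (AlgHom.ext fun φ => (hx φ).symm :
        (LocallyConstant.evalₐ k x).comp (eqv k K X).val = f)⟩⟩
    exact ⟨_, ⟨(asIso (evalHom hτ X)).symm⟩⟩

instance : (galFunctor (K := K) hτ).IsEquivalence where

end Galois

end

section

/-! ### Free and directly presented difference algebras -/

section Universal

variable {k : Type u} [Field k] {σ : k →+* k}

namespace DiffAlg

/-- A subalgebra stable under the shift. -/
def sub (B : DiffAlg σ) (S : Subalgebra k B) (hS : ∀ b ∈ S, B.shift b ∈ S) : DiffAlg σ where
  carrier := S
  shift := (B.shift.comp (S.val : S →+* B)).codRestrict S fun b => hS _ b.2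
  shift_algebraMap c := Subtype.ext (B.shift_algebraMap c)

/-- The inclusion of `sub`. -/
def subι (B : DiffAlg σ) (S : Subalgebra k B) (hS : ∀ b ∈ S, B.shift b ∈ S) : B.sub S hS ⟶ B where
  toAlgHom := S.val
  map_shift _ := rfl

theorem shift_mem_adjoin (B : DiffAlg σ) {T : Set B} (hT : ∀ b ∈ T, B.shift b ∈ T) :
    ∀ b ∈ Algebra.adjoin k T, B.shift b ∈ Algebra.adjoin k T := by
  intro b hb
  induction hb using Algebra.adjoin_induction with
  | mem a ha => exact Algebra.subset_adjoin (hT a ha)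
  | algebraMap c => rw [B.shift_algebraMap]; exact Subalgebra.algebraMap_mem _ _
  | add a b _ _ ha hb => rw [map_add]; exact add_mem ha hb
  | mul a b _ _ ha hb => rw [map_mul]; exact mul_mem ha hb

theorem map_shift_iterate {A B : DiffAlg σ} (h : A ⟶ B) (i : ℕ) (a : A) :
    h.toAlgHom (A.shift^[i] a) = B.shift^[i] (h.toAlgHom a) := by
  induction i with
  | zero => rfl
  | succ i ih => rw [Function.iterate_succ_apply', Function.iterate_succ_apply', h.map_shift, ih]

/-- `ι : C → B` is universal among the algebra homomorphisms `f` from `C` to difference algebras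
that satisfy the relations `f (s j) = shift (f (p j))`. -/
def IsUniversal {C J : Type u} [CommRing C] [Algebra k C] (s p : J → C) (B : DiffAlg σ)
    (ι : C →ₐ[k] B) : Prop :=
  (∀ j, ι (s j) = B.shift (ι (p j))) ∧
    ∀ (D : DiffAlg σ) (f : C →ₐ[k] D), (∀ j, f (s j) = D.shift (f (p j))) →
      ∃! h : B ⟶ D, h.toAlgHom.comp ι = f

theorem isFree_iff {A₀ : Type u} [CommRing A₀] [Algebra k A₀] {B : DiffAlg σ} {ι : A₀ →ₐ[k] B} :
    IsFree A₀ B ι ↔ IsUniversal (J := PEmpty) PEmpty.elim PEmpty.elim B ι :=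
  ⟨fun h => ⟨fun j => j.elim, fun D f _ => h D f⟩, fun h D f => h.2 D f fun j => j.elim⟩

/-- The component on `A₀` is redundant: `comm_p` recovers it from the one on `C₀`. So free and
presented algebras are both cases of `IsUniversal`. -/
theorem IsDirectlyPresented.isUniversal {Q : Cocorr σ} {B : DiffAlg σ} {v : Q.HomTo B}
    (h : IsDirectlyPresented Q B v) : IsUniversal Q.s Q.p B v.f₁ := by
  refine ⟨fun a => by rw [v.comm_s, v.comm_p], fun D f hf => ?_⟩
  obtain ⟨m, ⟨-, hm⟩, huniq⟩ := h D ⟨f.comp Q.p, f, fun _ => rfl, hf⟩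
  refine ⟨m, hm, fun m' hm' => huniq m' ⟨AlgHom.ext fun a => ?_, hm'⟩⟩
  refine Eq.trans ?_ (AlgHom.congr_fun hm' (Q.p a))
  exact congrArg m'.toAlgHom (v.comm_p a).symm

theorem IsUniversal.isDirectlyPresented {Q : Cocorr σ} {B : DiffAlg σ} {ι : Q.C₀ →ₐ[k] B}
    (h : IsUniversal Q.s Q.p B ι) :
    IsDirectlyPresented Q B ⟨ι.comp Q.p, ι, fun _ => rfl, h.1⟩ := by
  intro D w
  obtain ⟨m, hm, huniq⟩ := h.2 D w.f₁ fun a => by rw [w.comm_s, w.comm_p]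
  refine ⟨m, ⟨AlgHom.ext fun a => ?_, hm⟩, fun m' hm' => huniq m' hm'.2⟩
  exact (AlgHom.congr_fun hm (Q.p a)).trans (w.comm_p a)

theorem IsUniversal.of_iso {C J : Type u} [CommRing C] [Algebra k C] {s p : J → C}
    {B B' : DiffAlg σ} {ι : C →ₐ[k] B} (h : IsUniversal s p B ι) (e : B ≅ B') :
    IsUniversal s p B' (e.hom.toAlgHom.comp ι) := by
  refine ⟨fun j => ?_, fun D f hf => ?_⟩
  · rw [AlgHom.comp_apply, h.1, e.hom.map_shift]
    rfl
  · obtain ⟨m, hm, huniq⟩ := h.2 D f hf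
    refine ⟨e.inv ≫ m, ?_, fun m' hm' => ?_⟩
    · change ((e.hom ≫ e.inv ≫ m).toAlgHom).comp ι = f
      rw [Iso.hom_inv_id_assoc, hm]
    · rw [Iso.eq_inv_comp]
      exact huniq _ hm'

/-- The subalgebra generated by the shift iterates is stable under the shift, so universality maps
`B` into it; followed by the inclusion this fixes `ι`, so it is the identity. -/
theorem IsUniversal.adjoin_eq_top {C J : Type u} [CommRing C] [Algebra k C] {s p : J → C}
    {B : DiffAlg σ} {ι : C →ₐ[k] B} (h : IsUniversal s p B ι) :
    Algebra.adjoin k {b | ∃ (i : ℕ) (c : C), B.shift^[i] (ι c) = b} = ⊤ := by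
  set T : Set B := {b | ∃ (i : ℕ) (c : C), B.shift^[i] (ι c) = b}
  have hT : ∀ b ∈ T, B.shift b ∈ T := by
    rintro _ ⟨i, c, rfl⟩
    exact ⟨i + 1, c, Function.iterate_succ_apply' _ _ _⟩
  let D := B.sub _ (B.shift_mem_adjoin hT)
  let f : C →ₐ[k] Algebra.adjoin k T :=
    ι.codRestrict _ fun c => Algebra.subset_adjoin ⟨0, c, rfl⟩
  obtain ⟨m, hm, -⟩ := h.2 D f fun j => Subtype.ext (h.1 j)
  have h1 := (h.2 B ι h.1).unique (y₁ := m ≫ B.subι _ (B.shift_mem_adjoin hT)) (y₂ := 𝟙 B)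
    (AlgHom.ext fun c => congrArg Subtype.val (AlgHom.congr_fun hm c)) rfl
  refine eq_top_iff.2 fun b _ => ?_
  have h2 : (m ≫ B.subι _ (B.shift_mem_adjoin hT)).toAlgHom b = b := by rw [h1]; rfl
  rw [← h2]
  exact (m.toAlgHom b).2

section Construction

variable {C J : Type u} [CommRing C] [Algebra k C] (s p : J → C)

/-- The shift on the polynomial algebra with variables `(i, c)`, `i ∈ ℕ`, `c ∈ C`. -/
noncomputable def polyShift (σ : k →+* k) (C : Type u) :
    MvPolynomial (ℕ × C) k →+* MvPolynomial (ℕ × C) k :=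
  MvPolynomial.eval₂Hom (MvPolynomial.C.comp σ) fun q => MvPolynomial.X (q.1 + 1, q.2)

/-- The evaluation `X (i, c) ↦ shift^i (f c)`. -/
noncomputable def polyEval {D : DiffAlg σ} (f : C →ₐ[k] D) : MvPolynomial (ℕ × C) k →ₐ[k] D :=
  MvPolynomial.aeval fun q => D.shift^[q.1] (f q.2)

theorem polyEval_polyShift {D : DiffAlg σ} (f : C →ₐ[k] D) (q : MvPolynomial (ℕ × C) k) :
    polyEval f (polyShift σ C q) = D.shift (polyEval f q) := by
  induction q using MvPolynomial.induction_on with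
  | C a =>
    simp only [polyShift, polyEval, MvPolynomial.coe_eval₂Hom, MvPolynomial.eval₂_C,
      RingHom.comp_apply]
    rw [← MvPolynomial.algebraMap_eq, AlgHom.commutes, AlgHom.commutes, D.shift_algebraMap]
  | add a b ha hb => rw [map_add, map_add, map_add, map_add, ha, hb]
  | mul_X a q ha =>
    rw [map_mul, map_mul, map_mul, map_mul, ha]
    congr 1
    simp [polyShift, polyEval, Function.iterate_succ_apply']

/-- The relations of the universal difference algebra: the polynomials that vanish under all
admissible evaluations. -/
noncomputable def relIdeal (σ : k →+* k) : Ideal (MvPolynomial (ℕ × C) k) where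
  carrier := {q | ∀ (D : DiffAlg σ) (f : C →ₐ[k] D), (∀ j, f (s j) = D.shift (f (p j))) →
    polyEval f q = 0}
  add_mem' ha hb D f hf := by rw [map_add, ha D f hf, hb D f hf, add_zero]
  zero_mem' D f hf := map_zero _
  smul_mem' c q hq D f hf := by rw [smul_eq_mul, map_mul, hq D f hf, mul_zero]

/-- Variables `(i, c)` stand for `shift^i c`. Dividing by everything that vanishes in all admissible
targets reduces each identity in the quotient, including the ring structure of `C`, to one in those
targets. -/
theorem exists_isUniversal (σ : k →+* k) :
    ∃ (B : DiffAlg σ) (ι : C →ₐ[k] B), IsUniversal s p B ι := by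
  let I := relIdeal s p σ
  have hshift : I ≤ I.comap (polyShift σ C) := fun q hq D f hf => by
    rw [polyEval_polyShift, hq D f hf, map_zero]
  have hEq : ∀ q q', (∀ (D : DiffAlg σ) (f : C →ₐ[k] D), (∀ j, f (s j) = D.shift (f (p j))) →
      polyEval f q = polyEval f q') → Ideal.Quotient.mk I q = Ideal.Quotient.mk I q' :=
    fun q q' h => Ideal.Quotient.eq.2 fun D f hf => by rw [map_sub, h D f hf, sub_self]
  let B : DiffAlg σ :=
    { carrier := MvPolynomial (ℕ × C) k ⧸ I
      shift := Ideal.quotientMap I (polyShift σ C) hshift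
      shift_algebraMap := fun c => by
        refine (Ideal.quotientMap_mk (I := I) (x := MvPolynomial.C c)).trans ?_
        rw [polyShift, MvPolynomial.coe_eval₂Hom, MvPolynomial.eval₂_C]
        rfl }
  have hBs : ∀ q, B.shift (Ideal.Quotient.mk I q) = Ideal.Quotient.mk I (polyShift σ C q) :=
    fun q => Ideal.quotientMap_mk (H := hshift)
  have hX : ∀ {D : DiffAlg σ} (f : C →ₐ[k] D) i c,
      polyEval f (MvPolynomial.X (i, c)) = D.shift^[i] (f c) := fun f i c => by simp [polyEval]
  let ι : C →ₐ[k] B :=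
    { toFun := fun c => Ideal.Quotient.mk I (MvPolynomial.X (0, c))
      map_one' := (hEq _ 1 fun D f _ => by rw [hX]; simp).trans (map_one _)
      map_mul' := fun a b => (hEq _ (MvPolynomial.X (0, a) * MvPolynomial.X (0, b))
        fun D f _ => by rw [map_mul, hX, hX, hX]; simp).trans (map_mul _ _ _)
      map_zero' := (hEq _ 0 fun D f _ => by rw [hX]; simp).trans (map_zero _)
      map_add' := fun a b => (hEq _ (MvPolynomial.X (0, a) + MvPolynomial.X (0, b))
        fun D f _ => by rw [map_add, hX, hX, hX]; simp).trans (map_add _ _ _)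
      commutes' := fun c => hEq _ (algebraMap k _ c) fun D f _ => by
        rw [hX, AlgHom.commutes]; simp }
  have hι : ∀ c, ι c = Ideal.Quotient.mk I (MvPolynomial.X (0, c)) := fun _ => rfl
  have hιi : ∀ i c, B.shift^[i] (ι c) = Ideal.Quotient.mk I (MvPolynomial.X (i, c)) := by
    intro i c
    induction i with
    | zero => rfl
    | succ i ih =>
      rw [Function.iterate_succ_apply', ih, hBs]
      simp [polyShift]
  refine ⟨B, ι, fun j => ?_, fun D f hf => ?_⟩
  · rw [hι, ← Function.iterate_one B.shift, hιi]
    refine hEq _ _ fun D f hf => ?_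
    rw [hX, hX]
    exact hf j
  · let m : B ⟶ D :=
      { toAlgHom := Ideal.Quotient.liftₐ I (polyEval f) fun q hq => hq D f hf
        map_shift := fun b => by
          obtain ⟨q, rfl⟩ := Ideal.Quotient.mk_surjective b
          rw [hBs]
          exact polyEval_polyShift f q }
    refine ⟨m, AlgHom.ext fun c => hX f 0 c, fun m' hm' => ?_⟩
    refine DiffAlg.Hom.ext ?_
    refine Ideal.Quotient.algHom_ext _ ?_
    refine MvPolynomial.algHom_ext fun q => ?_
    have h1 : m'.toAlgHom (Ideal.Quotient.mk I (MvPolynomial.X q)) = D.shift^[q.1] (f q.2) := by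
      rw [← hιi, map_shift_iterate, ← AlgHom.comp_apply, hm']
    exact h1.trans (hX f q.1 q.2).symm

end Construction

end DiffAlg

end Universal

end

section

/-! ### Morphisms into free difference profinite sets -/

namespace DiffGProf

variable {G : Type u} [Group G] [TopologicalSpace G] {φ : G →ₜ* G}

theorem shift_iterate_smul (X : DiffGProf φ) (i : ℕ) (g : G) (x : X) :
    X.shift^[i] (g • x) = φ^[i] g • X.shift^[i] x := by
  induction i with
  | zero => rfl
  | succ i ih =>
    rw [Function.iterate_succ_apply', ih, X.shift_smul, Function.iterate_succ_apply',
      Function.iterate_succ_apply']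

theorem map_shift_iterate {X Y : DiffGProf φ} (h : X ⟶ Y) (i : ℕ) (x : X) :
    h.toFun (X.shift^[i] x) = Y.shift^[i] (h.toFun x) := by
  induction i with
  | zero => rfl
  | succ i ih => rw [Function.iterate_succ_apply', Function.iterate_succ_apply', h.map_shift, ih]

variable {X₀ : Type u} [Finite X₀] [TopologicalSpace X₀] [DiscreteTopology X₀] [MulAction G X₀]
  [ContinuousSMul G X₀]

theorem free_shift_iterate (x : free φ X₀) (i j : ℕ) :
    ((free φ X₀).shift^[i] x : ℕ → X₀) j = (x : ℕ → X₀) (i + j) := by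
  induction i generalizing x with
  | zero => rw [Nat.zero_add]; rfl
  | succ i ih =>
    rw [Function.iterate_succ_apply, ih]
    change (x : ℕ → X₀) (i + j + 1) = _
    rw [Nat.add_right_comm]

/-- The morphism to the free object induced by a continuous equivariant map. -/
def toFree {X : DiffGProf φ} (u : X → X₀) (hu : Continuous u)
    (hg : ∀ (g : G) x, u (g • x) = g • u x) : X ⟶ free φ X₀ where
  toFun x := fun i => u (X.shift^[i] x)
  continuous_toFun := continuous_pi fun i => hu.comp (X.continuous_shift.iterate i)
  map_smul g x := funext fun i => by
    rw [shift_iterate_smul, hg]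
    rfl
  map_shift x := rfl

/-- The zeroth component of a morphism to a free object. -/
def head {X : DiffGProf φ} (h : X ⟶ free φ X₀) (x : X) : X₀ := (h.toFun x : ℕ → X₀) 0

theorem continuous_head {X : DiffGProf φ} (h : X ⟶ free φ X₀) : Continuous (head h) :=
  (continuous_apply (A := fun _ : ℕ => X₀) 0).comp h.continuous_toFun

theorem head_smul {X : DiffGProf φ} (h : X ⟶ free φ X₀) (g : G) (x : X) :
    head h (g • x) = g • head h x := by
  rw [head, h.map_smul]
  rfl

theorem head_shift_iterate {X : DiffGProf φ} (h : X ⟶ free φ X₀) (x : X) (i : ℕ) :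
    head h (X.shift^[i] x) = (h.toFun x : ℕ → X₀) i := by
  rw [head, map_shift_iterate, free_shift_iterate, Nat.add_zero]

theorem isFinFree_free : (free φ X₀).IsFinFree :=
  ⟨X₀, inferInstance, inferInstance, inferInstance, inferInstance, inferInstance, ⟨Iso.refl _⟩⟩

end DiffGProf

variable {k K : Type u} [Field k] [Field K] [Algebra k K] {σ : k →+* k} {τ : K →+* K}

/-! ### Points of étale algebras as finite discrete Galois sets -/

section FinitePoints

/-- A `k`-algebra with the identity as its shift. -/
def constAlg (C : Type u) [CommRing C] [Algebra k C] : DiffAlg (RingHom.id k) where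
  carrier := C
  shift := RingHom.id C
  shift_algebraMap _ := rfl

/-- The `K`-points of a `k`-algebra. -/
abbrev AlgPts (k K : Type u) [Field k] [Field K] [Algebra k K] (C : Type u) [CommRing C]
    [Algebra k C] : Type u := Pts K (constAlg (k := k) C)

variable {C : Type u} [CommRing C] [Algebra k C]

instance [Algebra.Etale k C] : Finite (AlgPts k K C) := by
  have : Module.Finite k C := Algebra.FormallyUnramified.finite_of_free k C
  exact inferInstanceAs (Finite (C →ₐ[k] K))

instance : T2Space (AlgPts k K C) := t2Space_pts _

instance [IsSepClosure k K] : ContinuousSMul Gal(K/k) (AlgPts k K C) := continuousSMul_pts _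

instance [Algebra.Etale k C] : DiscreteTopology (AlgPts k K C) := inferInstance

/-- The restriction of points along an algebra homomorphism. -/
def resPts {A : DiffAlg σ} (ι : C →ₐ[k] A) (f : Pts K A) : AlgPts k K C := f.hom.comp ι

theorem continuous_resPts {A : DiffAlg σ} (ι : C →ₐ[k] A) :
    Continuous (resPts (K := K) ι) := by
  let : TopologicalSpace K := ⊥
  exact (isClosedEmbedding_eval (K := K) (constAlg (k := k) C)).isInducing.continuous_iff.2
    (continuous_pi fun c => continuous_eval A (ι c))

end FinitePoints

section Separation

/-- By Stone–Weierstrass `K ⊗ S` maps onto the functions on the points, hence onto `K ⊗ A`; faithful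
flatness gives `S = A`. -/
theorem eq_top_of_separates_pts {A : DiffAlg σ} (hA : IsLocEtale τ A) (S : Subalgebra k A)
    (hS : ∀ f g : A →ₐ[k] K, (∀ a ∈ S, f a = g a) → f = g) : S = ⊤ := by
  have := compactSpace_pts hA
  let ev := (ptsEval K A).comp S.val
  have hsurj : Function.Surjective (lcExtend ev) := by
    rw [← AlgHom.range_eq_top]
    refine subalgebra_eq_top_of_separates _ fun f g hfg => ?_
    by_contra! h
    refine hfg (hS f g fun a ha => ?_)
    have := h _ ⟨1 ⊗ₜ ⟨a, ha⟩, rfl⟩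
    have h1 := lcExtend_tmul ev 1 ⟨a, ha⟩
    refine Eq.trans ?_ (this.trans ?_)
    · exact ((h1 f).trans (one_mul _)).symm
    · exact (h1 g).trans (one_mul _)
  have hcomp : ∀ z, lcExtend (ptsEval K A) (S.val.toLinearMap.lTensor K z) = lcExtend ev z := by
    intro z
    induction z with
    | zero => simp
    | add x y hx hy => rw [map_add, map_add, hx, hy, map_add]
    | tmul c a => exact LocallyConstant.ext fun f =>
        (lcExtend_tmul (ptsEval K A) c a.1 f).trans (lcExtend_tmul ev c a f).symm
  have hsurj' : Function.Surjective (S.val.toLinearMap.lTensor K) := by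
    intro z
    obtain ⟨w, hw⟩ := hsurj (lcExtend (ptsEval K A) z)
    exact ⟨w, (lcExtend_ptsEval_bijective_of_isLocEtale hA).1 ((hcomp w).trans hw)⟩
  have := (Module.FaithfullyFlat.lTensor_surjective_iff_surjective k K _).1 hsurj'
  refine eq_top_iff.2 fun a _ => ?_
  obtain ⟨b, rfl⟩ := this a
  exact b.2

end Separation

/-! ### Finite generation -/

section Galois

theorem ptsShift_iterate_spec
    (hτ : ∀ c : k, τ (algebraMap k K c) = algebraMap k K (σ c))
    {A : DiffAlg σ} (hA : IsLocEtale τ A) (i : ℕ) (f : Pts K A) (a : A) :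
    τ^[i] (((ptsShift hτ hA)^[i] f).hom a) = f.hom (A.shift^[i] a) := by
  induction i generalizing a with
  | zero => rfl
  | succ i ih =>
    rw [Function.iterate_succ_apply, Function.iterate_succ_apply',
      ptsShift_spec hτ hA ((ptsShift hτ hA)^[i] f) a]
    exact ih _

/-- The value of `f` at `shift^i (ι c)` is `τ^i` of the value of its `i`-th shift at `ι c`, so these
values determine `f` on generators. -/
theorem pts_ext_of_adjoin
    (hτ : ∀ c : k, τ (algebraMap k K c) = algebraMap k K (σ c))
    {A : DiffAlg σ} (hA : IsLocEtale τ A) {C : Type u} [CommRing C]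
    [Algebra k C] (ι : C →ₐ[k] A)
    (hι : Algebra.adjoin k {b | ∃ (i : ℕ) (c : C), A.shift^[i] (ι c) = b} = ⊤) {f g : Pts K A}
    (h : ∀ i c, ((ptsShift hτ hA)^[i] f).hom (ι c) = ((ptsShift hτ hA)^[i] g).hom (ι c)) :
    f = g := by
  refine AlgHom.ext_of_adjoin_eq_top hι ?_
  rintro _ ⟨i, c, rfl⟩
  exact (ptsShift_iterate_spec hτ hA i f _).symm.trans
    ((congrArg τ^[i] (h i c)).trans (ptsShift_iterate_spec hτ hA i g _))

variable [IsSepClosure k K] (hτ : ∀ c : k, τ (algebraMap k K c) = algebraMap k K (σ c))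

/-- The difference profinite set of points of a difference locally étale algebra. -/
noncomputable abbrev ptsProf {A : DiffAlg σ} (hA : IsLocEtale τ A) :
    DiffGProf (galShift (K := K) hτ) :=
  (galFunctor (K := K) hτ).obj (Opposite.op ⟨A, hA⟩)

/-- The morphism from the points of `A` to the sequences of points of `C` given by
`ι : C → A`. -/
noncomputable def seqHom {A : DiffAlg σ} (hA : IsLocEtale τ A) {C : Type u} [CommRing C]
    [Algebra k C] [Algebra.Etale k C] (ι : C →ₐ[k] A) :
    ptsProf hτ hA ⟶ DiffGProf.free (galShift (K := K) hτ) (AlgPts k K C) :=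
  DiffGProf.toFree (X := ptsProf hτ hA) (resPts ι) (continuous_resPts ι) fun _ _ => rfl

theorem seqHom_injective {A : DiffAlg σ} (hA : IsLocEtale τ A) {C : Type u} [CommRing C]
    [Algebra k C] [Algebra.Etale k C] (ι : C →ₐ[k] A)
    (hι : Algebra.adjoin k {b | ∃ (i : ℕ) (c : C), A.shift^[i] (ι c) = b} = ⊤) :
    Function.Injective (seqHom hτ hA ι).toFun := by
  intro f g h
  refine pts_ext_of_adjoin hτ hA ι hι fun i c => ?_
  have h1 : resPts ι ((ptsShift hτ hA)^[i] f) = resPts ι ((ptsShift hτ hA)^[i] g) := congrFun h i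
  exact AlgHom.congr_fun h1 c

theorem isFinGen_ptsProf {A : DiffAlg σ} (h : IsFinGenEtale τ A) :
    (ptsProf hτ h.1).IsFinGen := by
  obtain ⟨hA, A₀, _, _, _, B, ι, q, hB, hq⟩ := h
  have hB' := (DiffAlg.isFree_iff.1 hB).adjoin_eq_top
  have hι : Algebra.adjoin k {b | ∃ (i : ℕ) (c : A₀), A.shift^[i] (q.toAlgHom.comp ι c) = b} =
      ⊤ := by
    have h1 := congrArg (Subalgebra.map q.toAlgHom) hB'
    rw [Algebra.map_top, (AlgHom.range_eq_top _).2 hq, AlgHom.map_adjoin] at h1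
    rw [← h1]
    congr 1
    ext b
    constructor
    · rintro ⟨i, c, rfl⟩
      exact ⟨_, ⟨i, c, rfl⟩, DiffAlg.map_shift_iterate q i _⟩
    · rintro ⟨_, ⟨i, c, rfl⟩, rfl⟩
      exact ⟨i, c, (DiffAlg.map_shift_iterate q i _).symm⟩
  exact ⟨_, seqHom hτ hA (q.toAlgHom.comp ι), DiffGProf.isFinFree_free,
    DiffGProf.mono_of_injective _ (seqHom_injective hτ hA _ hι)⟩

/-- A difference locally étale algebra is isomorphic to the algebra of equivariant locally
constant functions on its points. -/
noncomputable def eqvEquiv {A : DiffAlg σ} (hA : IsLocEtale τ A) : A ≃ₐ[k] eqv k K (Pts K A) :=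
  AlgEquiv.ofBijective ((ptsEval K A).codRestrict (eqv k K (Pts K A)) fun _ _ _ => rfl)
    ⟨fun _ _ h => eq_of_forall_pts (K := K) hA fun f =>
      LocallyConstant.congr_fun (congrArg Subtype.val h) f,
    fun φ => (exists_eq_eval_pts hA φ).imp fun _ h => Subtype.ext (LocallyConstant.ext h)⟩

theorem eqvEquiv_symm_apply {A : DiffAlg σ} (hA : IsLocEtale τ A) (φ : eqv k K (Pts K A))
    (f : Pts K A) : f.hom ((eqvEquiv hA).symm φ) = φ.1 f :=
  congrArg (fun ψ : eqv k K (Pts K A) => ψ.1 f) ((eqvEquiv hA).apply_symm_apply φ)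

/-- The zeroth component `u` of the embedding is an equivariant map to a finite set; pulling back
functions along it gives `ι₀`. The range of `q` separates points since the sequence of `u` on all
shifts does. -/
theorem isFinGenEtale_of_isFinGen {A : DiffAlg σ} (hA : IsLocEtale τ A)
    (h : (ptsProf hτ hA).IsFinGen) : IsFinGenEtale τ A := by
  have : IsGalois k K := inferInstance
  obtain ⟨Y, i, ⟨X₀, _, _, _, _, _, ⟨e⟩⟩, hi⟩ := h
  let j := i ≫ e.hom
  have hj : Function.Injective j.toFun := DiffGProf.injective_of_mono j
  have : Algebra.Etale k (eqv k K X₀) := etale_eqv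
  let u : Pts K A → X₀ := DiffGProf.head j
  let ι₀ : eqv k K X₀ →ₐ[k] A := (eqvEquiv hA).symm.toAlgHom.comp
    (eqvPullback u (DiffGProf.continuous_head j) (DiffGProf.head_smul j))
  have hι₀ : ∀ (f : Pts K A) a, f.hom (ι₀ a) = a.1 (u f) := fun f a =>
    eqvEquiv_symm_apply hA _ f
  obtain ⟨B, ι, hB⟩ := DiffAlg.exists_isUniversal (C := eqv k K X₀) (J := PEmpty) PEmpty.elim
    PEmpty.elim σ
  obtain ⟨q, hq, -⟩ := hB.2 A ι₀ fun j => j.elim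
  refine ⟨hA, eqv k K X₀, inferInstance, inferInstance, inferInstance, B, ι, q,
    DiffAlg.isFree_iff.2 hB, ?_⟩
  rw [← AlgHom.range_eq_top]
  refine eq_top_of_separates_pts hA _ fun f g hfg => hj (funext fun n => ?_)
  refine (DiffGProf.head_shift_iterate j f n).symm.trans
    (Eq.trans ?_ (DiffGProf.head_shift_iterate j g n))
  change u ((ptsShift hτ hA)^[n] f) = u ((ptsShift hτ hA)^[n] g)
  by_contra hne
  obtain ⟨φ, hφ, hφne⟩ := eqv_separates (k := k) (K := K) hne
  refine hφne ((hι₀ _ ⟨φ, hφ⟩).symm.trans (Eq.trans ?_ (hι₀ _ ⟨φ, hφ⟩)))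
  -- Applying `τ^[n]` turns values at the `n`-th shifted point into values of the point itself at
  -- `shift^n`, which lies in the range of `q`.
  refine Function.Injective.iterate τ.injective n ?_
  refine (ptsShift_iterate_spec hτ hA n f _).trans
    (Eq.trans ?_ (ptsShift_iterate_spec hτ hA n g _).symm)
  refine hfg _ ⟨B.shift^[n] (ι ⟨φ, hφ⟩), ?_⟩
  exact (DiffAlg.map_shift_iterate q n _).trans
    (congrArg A.shift^[n] (AlgHom.congr_fun hq _))

end Galois

end

section

/-! ### Twisted finite sets and dependence on finitely many terms -/

section TwistedActions

variable {G : Type u} [Group G] [TopologicalSpace G]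

/-- A `G`-set with the action pulled back along an endomorphism of `G`. -/
def Twist (_φ : G →ₜ* G) (X₀ : Type u) : Type u := X₀

/-- The finite sequences in `X₀`, where `G` acts on the `i`-th factor through the `i`-th iterate
of an endomorphism. -/
def TwistedTuple (_φ : G →ₜ* G) (X₀ : Type u) (n : ℕ) : Type u := Fin n → X₀

variable {φ : G →ₜ* G} {X₀ : Type u} {n : ℕ}

instance [Finite X₀] : Finite (Twist φ X₀) := inferInstanceAs (Finite X₀)

instance [TopologicalSpace X₀] : TopologicalSpace (Twist φ X₀) :=
  inferInstanceAs (TopologicalSpace X₀)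

instance [TopologicalSpace X₀] [DiscreteTopology X₀] : DiscreteTopology (Twist φ X₀) :=
  inferInstanceAs (DiscreteTopology X₀)

instance [MulAction G X₀] : MulAction G (Twist φ X₀) :=
  MulAction.compHom X₀ (φ : G →* G)

instance [TopologicalSpace X₀] [MulAction G X₀] [ContinuousSMul G X₀] :
    ContinuousSMul G (Twist φ X₀) where
  continuous_smul := by
    change Continuous fun q : G × X₀ => φ q.1 • q.2
    exact (φ.continuous_toFun.comp continuous_fst).smul continuous_snd

instance [Finite X₀] : Finite (TwistedTuple φ X₀ n) := inferInstanceAs (Finite (Fin n → X₀))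

instance [TopologicalSpace X₀] : TopologicalSpace (TwistedTuple φ X₀ n) :=
  inferInstanceAs (TopologicalSpace (Fin n → X₀))

instance [TopologicalSpace X₀] [DiscreteTopology X₀] : DiscreteTopology (TwistedTuple φ X₀ n) :=
  inferInstanceAs (DiscreteTopology (Fin n → X₀))

instance [MulAction G X₀] : MulAction G (TwistedTuple φ X₀ n) where
  smul g v := fun i => (φ^[(i : ℕ)] g) • v i
  one_smul v := funext fun i => by
    change (φ^[(i : ℕ)] 1) • v i = v i
    rw [iterate_map_one, one_smul]
  mul_smul g h v := funext fun i => by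
    change (φ^[(i : ℕ)] (g * h)) • v i = (φ^[(i : ℕ)] g) • (φ^[(i : ℕ)] h) • v i
    rw [iterate_map_mul, mul_smul]

instance [TopologicalSpace X₀] [MulAction G X₀] [ContinuousSMul G X₀] :
    ContinuousSMul G (TwistedTuple φ X₀ n) where
  continuous_smul := continuous_pi fun i => by
    change Continuous fun q : G × (Fin n → X₀) => (φ^[(i : ℕ)] q.1) • q.2 i
    exact ((φ.continuous_toFun.iterate i).comp continuous_fst).smul
      ((continuous_apply i).comp continuous_snd)

/-- The first entries of a finite sequence. -/
def TwistedTuple.init (v : TwistedTuple φ X₀ (n + 1)) : TwistedTuple φ X₀ n :=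
  fun i => v i.castSucc

/-- The last entries of a finite sequence. -/
def TwistedTuple.tail (v : TwistedTuple φ X₀ (n + 1)) : TwistedTuple φ X₀ n :=
  fun i => v i.succ

/-- A continuous map from the sequences in a finite set to a discrete set depends only on finitely
many terms. -/
theorem exists_forall_eq_of_agree {X₀ Z : Type*} [Finite X₀] [TopologicalSpace X₀]
    [DiscreteTopology X₀] [TopologicalSpace Z] [DiscreteTopology Z] (f : (ℕ → X₀) → Z)
    (hf : Continuous f) : ∃ N, ∀ x y : ℕ → X₀, (∀ i < N, x i = y i) → f x = f y := by
  obtain ⟨N, hN⟩ : ∃ N, ∀ x ∈ (Set.univ : Set (ℕ → X₀)), ∀ y, (∀ i < N, x i = y i) →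
      f x = f y := by
    refine isCompact_univ.induction_on
      (p := fun C => ∃ N, ∀ x ∈ C, ∀ y, (∀ i < N, x i = y i) → f x = f y) ⟨0, by simp⟩ ?_ ?_ ?_
    · rintro C D hCD ⟨N, hN⟩
      exact ⟨N, fun x hx => hN x (hCD hx)⟩
    · rintro C D ⟨N, hN⟩ ⟨M, hM⟩
      refine ⟨max N M, ?_⟩
      rintro x (hx | hx) y h
      · exact hN x hx y fun i hi => h i (lt_max_of_lt_left hi)
      · exact hM x hx y fun i hi => h i (lt_max_of_lt_right hi)
    · intro x _
      have hU : f ⁻¹' {f x} ∈ nhds x := ((isOpen_discrete _).preimage hf).mem_nhds rfl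
      obtain ⟨_, ⟨z, N, rfl⟩, hx, hN⟩ :=
        (PiNat.isTopologicalBasis_cylinders fun _ : ℕ => X₀).mem_nhds_iff.1 hU
      refine ⟨PiNat.cylinder z N, mem_nhdsWithin_of_mem_nhds
        ((PiNat.isOpen_cylinder _ z N).mem_nhds hx), N, fun w hw y hwy => ?_⟩
      have h1 : f w = f x := hN hw
      have h2 : f y = f x := hN (fun i hi => (hwy i hi).symm.trans (hw i hi))
      rw [h1, h2]
  exact ⟨N, fun x => hN x trivial⟩

end TwistedActions

variable {k K : Type u} [Field k] [Field K] [Algebra k K] {σ : k →+* k} {τ : K →+* K}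

/-- The sequences in `K` as a difference algebra. -/
def seqAlg (hτ : ∀ c : k, τ (algebraMap k K c) = algebraMap k K (σ c)) : DiffAlg σ where
  carrier := ℕ → K
  shift :=
    { toFun := fun d i => τ (d (i + 1))
      map_one' := funext fun _ => map_one τ
      map_mul' := fun _ _ => funext fun _ => map_mul τ _ _
      map_zero' := funext fun _ => map_zero τ
      map_add' := fun _ _ => funext fun _ => map_add τ _ _ }
  shift_algebraMap c := funext fun _ => hτ c

/-- A point along a ring homomorphism that is linear over `σ` and takes values in the range of
`τ`. -/
theorem exists_point_of_range (hτ : ∀ c : k, τ (algebraMap k K c) = algebraMap k K (σ c))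
    {C : Type u} [CommRing C] [Algebra k C] (g : C →+* K)
    (hg : ∀ c : k, g (algebraMap k C c) = algebraMap k K (σ c)) (h : ∀ c, ∃ y, τ y = g c) :
    ∃ f : C →ₐ[k] K, ∀ c, τ (f c) = g c := by
  choose f hf using h
  exact ⟨{
    toFun := f
    map_one' := τ.injective (by rw [hf, map_one, map_one])
    map_mul' := fun a b => τ.injective (by rw [hf, map_mul, map_mul, hf, hf])
    map_zero' := τ.injective (by rw [hf, map_zero, map_zero])
    map_add' := fun a b => τ.injective (by rw [hf, map_add, map_add, hf, hf])
    commutes' := fun c => τ.injective (by rw [hf, hg, hτ]) }, hf⟩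

/-! ### Points of a universal difference algebra -/

section Universal

variable (hτ : ∀ c : k, τ (algebraMap k K c) = algebraMap k K (σ c))
  {C J : Type u} [CommRing C] [Algebra k C] {s p : J → C} {B : DiffAlg σ} {ι : C →ₐ[k] B}

/-- Compatible sequences of points of `C` are sequences of restrictions of points of the universal
difference algebra. -/
theorem exists_pts_of_seq (h : DiffAlg.IsUniversal s p B ι) (hB : IsLocEtale τ B)
    (e : ℕ → (C →ₐ[k] K)) (he : ∀ i j, e i (s j) = τ (e (i + 1) (p j))) :
    ∃ f : Pts K B, ∀ i c, ((ptsShift hτ hB)^[i] f).hom (ι c) = e i c := by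
  -- The sequence is a single homomorphism to `K^ℕ` with shift `d ↦ (τ (d (i + 1)))`, compatible
  -- with the relations. The coordinates of its extension to `B` are the successive shifts of
  -- coordinate 0.
  let w : C →ₐ[k] (ℕ → K) := AlgHom.pi (R := k) (A := fun _ : ℕ => K) e
  obtain ⟨m, hm, -⟩ := h.2 (seqAlg hτ) w fun j => funext fun i => he i j
  let m' : B →ₐ[k] (ℕ → K) := m.toAlgHom
  have hms : ∀ b i, m' (B.shift b) i = τ (m' b (i + 1)) := fun b i => congrFun (m.map_shift b) i
  let pt : ℕ → Pts K B := fun i => (Pi.evalAlgHom k (fun _ => K) i).comp m'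
  have hpt : ∀ i, (ptsShift hτ hB)^[i] (pt 0) = pt i := by
    intro i
    induction i with
    | zero => rfl
    | succ i ih =>
      rw [Function.iterate_succ_apply', ih]
      refine AlgHom.ext fun b => τ.injective ?_
      exact (ptsShift_spec hτ hB (pt i) b).trans (hms b i)
  refine ⟨pt 0, fun i c => ?_⟩
  rw [hpt]
  exact congrFun (AlgHom.congr_fun hm c) i

theorem resPts_relation (h : DiffAlg.IsUniversal s p B ι) (hB : IsLocEtale τ B) (f : Pts K B)
    (i : ℕ) (j : J) : ((ptsShift hτ hB)^[i] f).hom (ι (s j)) =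
      τ (((ptsShift hτ hB)^[i + 1] f).hom (ι (p j))) := by
  rw [h.1, Function.iterate_succ_apply']
  exact (ptsShift_spec hτ hB ((ptsShift hτ hB)^[i] f) _).symm

theorem isLocEtale_of_isUniversal [IsSepClosure k K]
    (hτ : ∀ c : k, τ (algebraMap k K c) = algebraMap k K (σ c)) [Algebra.Etale k C]
    (h : DiffAlg.IsUniversal s p B ι) : IsLocEtale τ B := by
  refine isLocEtale_of_adjoin_eq_top hτ B h.adjoin_eq_top ?_
  rintro _ ⟨i, c, rfl⟩
  refine IsSplitElt.shift_iterate hτ B ?_ i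
  exact (isSplitElt_of_etale (K := K) c).imp fun t ht => by
    have := congrArg (Algebra.TensorProduct.map (AlgHom.id K K) ι) ht
    rw [map_prod, map_zero] at this
    rw [← this]
    exact Finset.prod_congr rfl fun y _ => by simp

end Universal

theorem isLocEtale_of_isFinPresEtale [IsSepClosure k K]
    (hτ : ∀ c : k, τ (algebraMap k K c) = algebraMap k K (σ c)) {A : DiffAlg σ}
    (h : IsFinPresEtale A) : IsLocEtale τ A := by
  obtain ⟨Q, v, _, _, hv⟩ := h
  exact isLocEtale_of_isUniversal hτ hv.isUniversal

/-! ### From cocorrespondences to equalisers -/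

section Galois

variable [IsSepClosure k K] (hτ : ∀ c : k, τ (algebraMap k K c) = algebraMap k K (σ c))

theorem isFinPres_ptsProf {A : DiffAlg σ} (hA : IsLocEtale τ A) (h : IsFinPresEtale A) :
    (ptsProf hτ hA).IsFinPres := by
  obtain ⟨Q, v, _, _, hv⟩ := h
  have hU := hv.isUniversal
  -- The composite `e ∘ s` is only `σ`-linear, but splitness of `A₀` places its values in the range
  -- of `τ`, so it is `τ` after a genuine point.
  have hs : ∀ e : AlgPts k K Q.C₀, ∃ f : AlgPts k K Q.A₀, ∀ a : Q.A₀,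
      τ (f.hom a) = e.hom (Q.s a) := by
    intro e'
    let e : Q.C₀ →ₐ[k] K := e'
    have hg : ∀ c : k, ((e : Q.C₀ →+* K).comp Q.s) (algebraMap k Q.A₀ c) =
        algebraMap k K (σ c) := fun c =>
      (congrArg e (Q.s_algebraMap c)).trans (e.commutes _)
    exact exists_point_of_range hτ ((e : Q.C₀ →+* K).comp Q.s) hg fun a =>
      (isSplitElt_of_etale (K := K) a).exists_eq τ _ fun c => by rw [hτ, hg]
  choose s' hs' using hs
  let φ := galShift (K := K) hτ
  let E := AlgPts k K Q.C₀
  -- The twist makes both maps equivariant: restriction along `s` turns `g` into `g^σ`, and on the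
  -- term with index 1 the group already acts through `φ`.
  let V := Twist φ (AlgPts k K Q.A₀)
  let F := DiffGProf.free φ E
  let u₁ : F → V := fun x => s' ((x : ℕ → E) 0)
  let p' : E → V := fun e => resPts (A := constAlg (k := k) Q.C₀) Q.p e
  let u₂ : F → V := fun x => p' ((x : ℕ → E) 1)
  have hu₁ : Continuous u₁ := (continuous_of_discreteTopology (f := (s' : E → V))).comp
    (continuous_apply (A := fun _ : ℕ => E) 0)
  have hu₂ : Continuous u₂ := (continuous_of_discreteTopology (f := p')).comp
    (continuous_apply (A := fun _ : ℕ => E) 1)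
  have hg₁ : ∀ (g : Gal(K/k)) x, u₁ (g • x) = g • u₁ x := by
    intro g x
    refine AlgHom.ext fun a => τ.injective ?_
    refine (hs' (g • (x : ℕ → E) 0) a).trans ?_
    refine Eq.trans ?_ (galTwist_spec hτ g _).symm
    exact congrArg g (hs' ((x : ℕ → E) 0) a).symm
  have hg₂ : ∀ (g : Gal(K/k)) x, u₂ (g • x) = g • u₂ x := fun g x => rfl
  let f₁ : F ⟶ DiffGProf.free φ V := DiffGProf.toFree u₁ hu₁ hg₁
  let f₂ : F ⟶ DiffGProf.free φ V := DiffGProf.toFree u₂ hu₂ hg₂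
  have hf : ∀ x : F, f₁.toFun x = f₂.toFun x ↔
      ∀ i a, ((x : ℕ → E) i).hom (Q.s a) = τ (((x : ℕ → E) (i + 1)).hom (Q.p a)) := by
    intro x
    have h0 : f₁.toFun x = f₂.toFun x ↔ ∀ i, s' ((x : ℕ → E) i) = p' ((x : ℕ → E) (i + 1)) := by
      refine funext_iff.trans (forall_congr' fun i => ?_)
      have e₁ := DiffGProf.free_shift_iterate x i 0
      have e₂ := DiffGProf.free_shift_iterate x i 1
      change s' ((F.shift^[i] x : ℕ → E) 0) = p' ((F.shift^[i] x : ℕ → E) 1) ↔ _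
      rw [e₁, e₂]
      rfl
    rw [h0]
    refine forall_congr' fun i => ?_
    refine AlgHom.ext_iff.trans (forall_congr' fun a => ?_)
    exact ⟨fun h => (hs' _ a).symm.trans (congrArg τ h),
      fun h => τ.injective ((hs' _ a).trans h)⟩
  let i := seqHom hτ hA v.f₁
  have w : i ≫ f₁ = i ≫ f₂ := DiffGProf.hom_ext fun f =>
    (hf _).2 fun n a => resPts_relation hτ hU hA f n a
  refine ⟨F, _, f₁, f₂, i, w, DiffGProf.isFinFree_free, DiffGProf.isFinFree_free,
    DiffGProf.nonempty_isLimit_fork i w (seqHom_injective hτ hA _ hU.adjoin_eq_top) ?_⟩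
  intro y hy
  obtain ⟨f, hf'⟩ := exists_pts_of_seq hτ hU hA (fun i => ((y : ℕ → E) i).hom) ((hf y).1 hy)
  exact ⟨f, funext fun n => AlgHom.ext fun c => hf' n c⟩

end Galois

end

section

/-! ### From equalisers to cocorrespondences -/

theorem eqv_ext {k K : Type*} [Field k] [Field K] [Algebra k K] [IsGalois k K] {X : Type*}
    [TopologicalSpace X] [CompactSpace X] [T2Space X] [TotallyDisconnectedSpace X]
    [MulAction Gal(K/k) X] [ContinuousSMul Gal(K/k) X] {x y : X}
    (h : ∀ φ : eqv k K X, φ.1 x = φ.1 y) : x = y := by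
  by_contra hne
  obtain ⟨φ, hφ, hφne⟩ := eqv_separates (k := k) (K := K) hne
  exact hφne (h ⟨φ, hφ⟩)

namespace DiffGProf

variable {G : Type u} [Group G] [TopologicalSpace G] {φ : G →ₜ* G}

theorem hom_eq_iff_head {Y : DiffGProf φ} {X₀ : Type u} [Finite X₀] [TopologicalSpace X₀]
    [DiscreteTopology X₀] [MulAction G X₀] [ContinuousSMul G X₀] (f g : Y ⟶ free φ X₀) (y : Y) :
    f.toFun y = g.toFun y ↔ ∀ n, head f (Y.shift^[n] y) = head g (Y.shift^[n] y) := by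
  refine funext_iff.trans (forall_congr' fun n => ?_)
  rw [head_shift_iterate, head_shift_iterate]

/-- A finitely presented object is the equaliser of two morphisms between free objects. -/
theorem IsFinPres.exists_free {X : DiffGProf φ} (h : X.IsFinPres) :
    ∃ (X₀ : Type u) (_ : Finite X₀) (_ : TopologicalSpace X₀) (_ : DiscreteTopology X₀)
      (_ : MulAction G X₀) (_ : ContinuousSMul G X₀)
      (Z₀ : Type u) (_ : Finite Z₀) (_ : TopologicalSpace Z₀) (_ : DiscreteTopology Z₀)
      (_ : MulAction G Z₀) (_ : ContinuousSMul G Z₀)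
      (i : X ⟶ free φ X₀) (f g : free φ X₀ ⟶ free φ Z₀),
      Function.Injective i.toFun ∧ Set.range i.toFun = {x | f.toFun x = g.toFun x} := by
  obtain ⟨Y, Z, f, g, i, w, ⟨X₀, a₁, a₂, a₃, a₄, a₅, ⟨eY⟩⟩,
    ⟨Z₀, b₁, b₂, b₃, b₄, b₅, ⟨eZ⟩⟩, ⟨hl⟩⟩ := h
  have : Mono i := Limits.mono_of_isLimit_fork hl
  refine ⟨X₀, a₁, a₂, a₃, a₄, a₅, Z₀, b₁, b₂, b₃, b₄, b₅, i ≫ eY.hom,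
    eY.inv ≫ f ≫ eZ.hom, eY.inv ≫ g ≫ eZ.hom, injective_of_mono _, ?_⟩
  ext x
  constructor
  · rintro ⟨t, rfl⟩
    have h1 : (i ≫ eY.hom) ≫ eY.inv ≫ f ≫ eZ.hom = (i ≫ eY.hom) ≫ eY.inv ≫ g ≫ eZ.hom := by
      simp only [Category.assoc, Iso.hom_inv_id_assoc]
      rw [← Category.assoc, w, Category.assoc]
    exact toFun_eq_of_eq h1 t
  · intro hx
    have h1 : f.toFun (eY.inv.toFun x) = g.toFun (eY.inv.toFun x) := injective_of_mono eZ.hom hx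
    obtain ⟨t, ht⟩ : eY.inv.toFun x ∈ Set.range i.toFun := by rw [fork_range hl]; exact h1
    refine ⟨t, ?_⟩
    rw [comp_toFun, ht, ← comp_toFun, eY.inv_hom_id]
    rfl

/-- The windows of length `n` of sequences in `X₀` that force two morphisms to have the same
head. -/
def windows {X₀ Z₀ : Type u} [Finite X₀] [TopologicalSpace X₀]
    [DiscreteTopology X₀] [MulAction G X₀] [ContinuousSMul G X₀] [Finite Z₀] [TopologicalSpace Z₀]
    [DiscreteTopology Z₀] [MulAction G Z₀] [ContinuousSMul G Z₀] (f g : free φ X₀ ⟶ free φ Z₀)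
    (n : ℕ) : SubMulAction G (TwistedTuple φ X₀ n) where
  carrier := {v | ∀ y : free φ X₀, (∀ i : Fin n, (y : ℕ → X₀) i = v i) → head f y = head g y}
  smul_mem' a v hv y hy := by
    have h1 : head f (a⁻¹ • y) = head g (a⁻¹ • y) := by
      refine hv _ fun i => ?_
      change (φ^[(i : ℕ)] a⁻¹) • (y : ℕ → X₀) i = v i
      rw [hy]
      change (φ^[(i : ℕ)] a⁻¹) • (φ^[(i : ℕ)] a) • v i = v i
      rw [smul_smul, ← iterate_map_mul, inv_mul_cancel, iterate_map_one, one_smul]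
    rw [head_smul, head_smul] at h1
    exact smul_left_cancel _ h1

theorem mem_windows {X₀ Z₀ : Type u} [Finite X₀] [TopologicalSpace X₀]
    [DiscreteTopology X₀] [MulAction G X₀] [ContinuousSMul G X₀] [Finite Z₀] [TopologicalSpace Z₀]
    [DiscreteTopology Z₀] [MulAction G Z₀] [ContinuousSMul G Z₀] {f g : free φ X₀ ⟶ free φ Z₀}
    {n : ℕ} {v : TwistedTuple φ X₀ n} : v ∈ windows f g n ↔
      ∀ y : free φ X₀, (∀ i : Fin n, (y : ℕ → X₀) i = v i) → head f y = head g y := Iff.rfl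

end DiffGProf

variable {k K : Type u} [Field k] [Field K] [Algebra k K] [IsSepClosure k K] {σ : k →+* k}
  {τ : K →+* K} (hτ : ∀ c : k, τ (algebraMap k K c) = algebraMap k K (σ c))

/-- The points of the difference algebra presented by a finite set of windows. -/
theorem exists_hom_of_windows {X₀ : Type u} [Finite X₀] [TopologicalSpace X₀] [DiscreteTopology X₀]
    [MulAction Gal(K/k) X₀] [ContinuousSMul Gal(K/k) X₀] {N : ℕ}
    (E : SubMulAction Gal(K/k) (TwistedTuple (galShift (K := K) hτ) X₀ (N + 1)))
    {B : DiffAlg σ} {ι : eqv k K E →ₐ[k] B}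
    (hB : DiffAlg.IsUniversal
      (eqvTwistedPullback hτ (fun e : E => e.1.tail) continuous_of_discreteTopology fun _ _ => rfl)
      (eqvPullback (k := k) (K := K) (fun e : E => e.1.init) continuous_of_discreteTopology
        fun _ _ => rfl) B ι)
    (hBl : IsLocEtale τ B) :
    ∃ h : ptsProf hτ hBl ⟶ DiffGProf.free (galShift (K := K) hτ) X₀,
      Function.Injective h.toFun ∧ Set.range h.toFun =
        {x | ∀ n, (fun j => (x : ℕ → X₀) (n + j) : TwistedTuple (galShift hτ) X₀ (N + 1)) ∈ E} := by
  have : IsGalois k K := inferInstance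
  -- Restricted along `ι`, a point of `B` is a window in `E`.
  have hκ : ∀ f : Pts K B, ∃ e : E, ∀ a, f.hom (ι a) = a.1 e := fun f =>
    exists_eq_eval_eqv (k := k) (K := K) (f.hom.comp ι)
  choose κ hκ using hκ
  have hκ_eq : ∀ f e, (∀ a, f.hom (ι a) = a.1 e) → κ f = e := fun f e h =>
    eqv_ext (k := k) (K := K) fun a => (hκ f a).symm.trans (h a)
  have hκ_smul : ∀ (g : Gal(K/k)) f, κ (g • f) = g • κ f := fun g f => hκ_eq _ _ fun a => by
    rw [a.2]
    exact congrArg g (hκ f a)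
  have hκ_cont : Continuous κ := by
    let : TopologicalSpace K := ⊥
    have : DiscreteTopology K := ⟨rfl⟩
    let ev : E → eqv k K E → K := fun e a => a.1 e
    have hev : Topology.IsClosedEmbedding ev :=
      (continuous_of_discreteTopology (f := ev)).isClosedEmbedding fun e e' h =>
        eqv_ext (k := k) (K := K) (congrFun h)
    refine hev.isInducing.continuous_iff.2 (continuous_pi fun a => ?_)
    exact (continuous_eval B (ι a)).congr fun f => hκ f a
  let S : Pts K B → Pts K B := ptsShift hτ hBl
  -- The relations say that consecutive windows overlap, so the windows of the shifts of `f` are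
  -- those of the single sequence of zeroth entries `u`.
  have hrel : ∀ f, (κ f).1.tail = (κ (S f)).1.init := fun f => by
    refine eqv_ext (k := k) (K := K) fun a => τ.injective ?_
    have h1 := resPts_relation hτ hB hBl f 0 a
    exact (hκ f _).symm.trans (h1.trans (congrArg τ (hκ (S f) _)))
  let u : Pts K B → X₀ := fun f => (κ f).1 0
  have hwin : ∀ (j : ℕ) (hj : j < N + 1) f, (κ f).1 ⟨j, hj⟩ = u (S^[j] f) := by
    intro j
    induction j with
    | zero => intro _ _; rfl
    | succ j ih =>
      intro hj f
      rw [Function.iterate_succ_apply, ← ih (by omega) (S f)]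
      exact congrFun (hrel f) ⟨j, by omega⟩
  let h : ptsProf hτ hBl ⟶ DiffGProf.free (galShift (K := K) hτ) X₀ :=
    DiffGProf.toFree (X := ptsProf hτ hBl) u
      (((continuous_of_discreteTopology (f := fun e : E => e.1 0))).comp hκ_cont)
      fun g f => congrArg (fun e : E => e.1 0) (hκ_smul g f)
  have hh : ∀ f i, (h.toFun f : ℕ → X₀) i = u (S^[i] f) := fun _ _ => rfl
  have hκh : ∀ f i, (κ (S^[i] f)).1 = fun j : Fin (N + 1) => (h.toFun f : ℕ → X₀) (i + j) := by
    intro f i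
    funext j
    refine (hwin j j.2 _).trans (Eq.trans ?_ (hh f (i + j)).symm)
    rw [Nat.add_comm i, Function.iterate_add_apply]
  refine ⟨h, fun f g hfg => ?_, Set.Subset.antisymm ?_ fun x hx => ?_⟩
  · refine pts_ext_of_adjoin hτ hBl ι hB.adjoin_eq_top fun i c => ?_
    have h1 : κ (S^[i] f) = κ (S^[i] g) := Subtype.ext <| (hκh f i).trans <|
      (funext fun j : Fin (N + 1) => congrFun hfg (i + j)).trans (hκh g i).symm
    exact (hκ (S^[i] f) c).trans ((congrArg c.1 h1).trans (hκ (S^[i] g) c).symm)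
  · rintro _ ⟨f, rfl⟩ n
    rw [← hκh f n]
    exact (κ (S^[n] f)).2
  · let e : ℕ → E := fun n => ⟨_, hx n⟩
    obtain ⟨f, hf⟩ := exists_pts_of_seq hτ hB hBl
      (fun i => (LocallyConstant.evalₐ k (e i)).comp (eqv k K E).val) fun i a => by
        change τ (a.1 (e i).1.tail) = τ (a.1 (e (i + 1)).1.init)
        congr 2
        funext j
        change (x : ℕ → X₀) (i + (j + 1)) = (x : ℕ → X₀) (i + 1 + j)
        rw [Nat.add_assoc, Nat.add_comm 1]
    exact ⟨f, funext fun n => congrArg (fun v : E => v.1 0) (hκ_eq _ (e n) (hf n))⟩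

/-- The algebra presented by the windows has the same image as `A` in the free object, so their
point sets are isomorphic; full faithfulness of `galFunctor` lifts this to the algebras. -/
theorem isFinPresEtale_of_isFinPres {A : DiffAlg σ} (hA : IsLocEtale τ A)
    (h : (ptsProf hτ hA).IsFinPres) : IsFinPresEtale A := by
  obtain ⟨X₀, _, _, _, _, _, Z₀, _, _, _, _, _, i, f, g, hi, hrange⟩ := h.exists_free
  obtain ⟨N₁, hN₁⟩ := exists_forall_eq_of_agree (DiffGProf.head f) (DiffGProf.continuous_head f)
  obtain ⟨N₂, hN₂⟩ := exists_forall_eq_of_agree (DiffGProf.head g) (DiffGProf.continuous_head g)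
  -- Length `N` already determines both heads; the extra entry in `E` lets `init` and `tail` land in
  -- tuples of length `N`.
  let N := max N₁ N₂
  let E := DiffGProf.windows f g (N + 1)
  let Q : DiffAlg.Cocorr σ :=
    { A₀ := eqv k K (TwistedTuple (galShift (K := K) hτ) X₀ N)
      C₀ := eqv k K E
      p := eqvPullback (fun e : E => e.1.init) continuous_of_discreteTopology fun _ _ => rfl
      s := eqvTwistedPullback hτ (fun e : E => e.1.tail) continuous_of_discreteTopology
        fun _ _ => rfl
      s_algebraMap := eqvTwistedPullback_algebraMap hτ _ _ _ }
  have hA₀ : Algebra.Etale k Q.A₀ := etale_eqv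
  have hC₀ : Algebra.Etale k Q.C₀ := etale_eqv
  obtain ⟨B, ι, hB⟩ := DiffAlg.exists_isUniversal Q.s Q.p σ
  have hBl : IsLocEtale τ B := isLocEtale_of_isUniversal hτ hB
  obtain ⟨m, hm, hmrange⟩ := exists_hom_of_windows hτ E hB hBl
  have hEq : Set.range m.toFun = Set.range i.toFun := by
    rw [hmrange, hrange]
    ext x
    refine Iff.trans ?_ (DiffGProf.hom_eq_iff_head f g x).symm
    refine forall_congr' fun n => DiffGProf.mem_windows.trans ?_
    constructor
    · exact fun hx => hx _ fun j => DiffGProf.free_shift_iterate x n j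
    -- Both heads depend only on the window, so equality at the shift of `x` gives it for every
    -- sequence with that window.
    · intro hx y hy
      have hagree : ∀ j < N, (y : ℕ → X₀) j =
          ((DiffGProf.free (galShift (K := K) hτ) X₀).shift^[n] x : ℕ → X₀) j := fun j hj =>
        (hy ⟨j, by omega⟩).trans (DiffGProf.free_shift_iterate x n j).symm
      rw [hN₁ y _ fun j hj => hagree j (lt_max_of_lt_left hj),
        hN₂ y _ fun j hj => hagree j (lt_max_of_lt_right hj)]
      exact hx
  obtain ⟨e⟩ := DiffGProf.nonempty_iso_of_range_eq m i hm hi hEq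
  let e' : B ≅ A := (ObjectProperty.ι _).mapIso ((galFunctor (K := K) hτ).preimageIso e).unop.symm
  exact ⟨Q, _, hA₀, hC₀, (hB.of_iso e').isDirectlyPresented⟩

end

end DiffGal

theorem corollary3p33 {k K : Type u} [Field k] [Field K] [Algebra k K] [IsSepClosure k K]
    (σ : k →+* k) (τ : K →+* K) (hτ : ∀ c : k, τ (algebraMap k K c) = algebraMap k K (σ c)) :
    -- the functor `A ↦ Hom_k(A, K)` is an anti-equivalence
    (DiffGal.galFunctor (K := K) hτ).IsEquivalence ∧
    -- it restricts to finitely generated étale algebras and finitely generated profinite sets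
    DiffGal.RestrictsToEquivalence (DiffGal.galFunctor (K := K) hτ)
      (fun A => DiffGal.IsFinGenEtale τ A.unop.obj) (fun X => X.IsFinGen) ∧
    -- finitely presented étale algebras are difference locally étale
    (∀ A : DiffGal.DiffAlg σ, DiffGal.IsFinPresEtale A → DiffGal.IsLocEtale τ A) ∧
    -- it restricts to finitely presented étale algebras and finitely presented profinite sets
    DiffGal.RestrictsToEquivalence (DiffGal.galFunctor (K := K) hτ)
      (fun A => DiffGal.IsFinPresEtale A.unop.obj) (fun X => X.IsFinPres) := by
  refine ⟨inferInstance, ?_, fun A hA => DiffGal.isLocEtale_of_isFinPresEtale hτ hA, ?_⟩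
  · exact DiffGal.restrictsToEquivalence_of_iff _ _ _ (fun e hX => hX.of_iso e) fun A =>
      ⟨fun hA => DiffGal.isFinGen_ptsProf hτ hA,
        fun hA => DiffGal.isFinGenEtale_of_isFinGen hτ A.unop.property hA⟩
  · exact DiffGal.restrictsToEquivalence_of_iff _ _ _ (fun e hX => hX.of_iso e) fun A =>
      ⟨fun hA => DiffGal.isFinPres_ptsProf hτ A.unop.property hA,
        fun hA => DiffGal.isFinPresEtale_of_isFinPres hτ A.unop.property hA⟩
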